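/- Let $m\ge 1$ and $0\le t<m$ be integers, let $\mathcal X_1,\dots,\mathcal X_m$ be finite alphabets, and let $p$ be a probability distribution on $\mathcal X_1\times\cdots\times\mathcal X_m$, the law of $(X_1,\dots,X_m)$. Write $X_A=(X_i)_{i\in A}$, and let $(X_1^n,\dots,X_m^n)$ be $n$ independent copies of $(X_1,\dots,X_m)$; sensor $i$ observes $X_i^n$. Entropies are in bits. A fixed-rate code of block length $n$ and rates $(R_1,\dots,R_m)\in\mathbb R^m$ consists of encoders $f_i:\mathcal X_i^n\to\{1,\dots,\lfloor 2^{nR_i}\rfloor\}$, $i=1,\dots,m$, and a decoder $g$ that maps the received messages $(I_1,\dots,I_m)$ to estimates $(\hat X_1^n,\dots,\hat X_m^n)$. An unknown set $\mathcal H\subseteq\{1,\dots,m\}$ of sensors with $|\mathcal H|\ge m-t$ is honest, and the others are traitors. An honest sensor sends $I_i=f_i(X_i^n)$. The traitors choose their messages jointly and arbitrarily, possibly at random, as a function of all the source sequences $X_1^n,\dots,X_m^n$. The error probability is $P_e=\Pr\big(\hat X_i^n\ne X_i^n\text{ for some } i\in\mathcal H\big)$. The vector $(R_1,\dots,R_m)$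 is deterministic-fixed-rate achievable if for every $\epsilon>0$ and all sufficiently large $n$ there is such a code with $P_e\le\epsilon$ for every possible $\mathcal H$ and every behaviour of the traitors. It is randomized-fixed-rate achievable if the same holds when each encoder may be randomized, where the sensors' private randomness is independent across sensors and of the sources, and the traitors know nothing about the randomness of the honest sensors. Let $\mathscr R_{\mathrm{dfr}}$ and $\mathscr R_{\mathrm{rfr}}$ be the closures in $\mathbb R^m$ of the sets of deterministic- and of randomized-fixed-rate achievable vectors. For $1\le k\le m$ let $\mathscr R_k$ be the set of all $(R_1,\dots,R_m)\in\mathbb R^m$ such that for every $s\subseteq\{1,\dots,m\}$ with $|s|=k$ the vector $(R_i)_{i\in s}$ lies in the Slepian–Wolf region of $X_s$, that is, $\sum_{i\in A}R_i\ge H(X_A\mid X_{s\setminus A})$ for every nonempty $A\subseteq s$. Then $$\mathscr R_{\mathrm{dfr}}=\mathscr R_{\max\{1,\,m-2t\}}\qquad\text{and}\qquad \mathscr R_{\mathrm{rfr}}=\mathscr R_{m-t}.$$ -/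

import Mathlib

open Filter Topology

noncomputable section

namespace ByzantineSource

variable {m : ℕ} {𝒳 : Fin m → Type*} [∀ i, Fintype (𝒳 i)] [∀ i, DecidableEq (𝒳 i)]

/-- The marginal probability `p(x_A)`: the probability that the variables with index in `A` take
the values that they have in `x`. -/
def marginal (p : (∀ i, 𝒳 i) → ℝ) (A : Finset (Fin m)) (x : ∀ i, 𝒳 i) : ℝ :=
  ∑ y with ∀ i ∈ A, y i = x i, p y

/-- The conditional entropy `H(X_A | X_B)` in bits, i.e. the expectation of
`-log₂ (p(X_A, X_B) / p(X_B))`. -/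
def condEntropy (p : (∀ i, 𝒳 i) → ℝ) (A B : Finset (Fin m)) : ℝ :=
  ∑ x, p x * -Real.logb 2 (marginal p (A ∪ B) x / marginal p B x)

/-- The rate vectors whose coordinates in `s` lie in the Slepian-Wolf region of `X_s`. -/
def slepianWolf (p : (∀ i, 𝒳 i) → ℝ) (s : Finset (Fin m)) : Set (Fin m → ℝ) :=
  {R | ∀ A ⊆ s, A.Nonempty → condEntropy p A (s \ A) ≤ ∑ i ∈ A, R i}

/-- `𝓡_k`: for every set `s` of `k` sensors, the rates of the sensors in `s` lie in the
Slepian-Wolf region of `X_s`. -/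
def rateRegion (p : (∀ i, 𝒳 i) → ℝ) (k : ℕ) : Set (Fin m → ℝ) :=
  {R | ∀ s : Finset (Fin m), s.card = k → R ∈ slepianWolf p s}

/-- The number of messages available at rate `r` and block length `n`: the largest integer that is
at most `2 ^ (n r)`. -/
def numMsg (n : ℕ) (r : ℝ) : ℕ := ⌊(2 : ℝ) ^ ((n : ℝ) * r)⌋₊

/-- A joint message: one message for each sensor. -/
abbrev Msgs (n : ℕ) (R : Fin m → ℝ) : Type := ∀ i, Fin (numMsg n (R i))

/-- The messages at the decoder: those of the honest sensors in `H` are taken from `u`, those of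
the traitors from `a`. -/
def received {n : ℕ} {R : Fin m → ℝ} (H : Finset (Fin m)) (u a : Msgs n R) : Msgs n R :=
  fun i => if i ∈ H then u i else a i

/-- The probability that the decoder `g` does not return the source sequences of all honest
sensors. The source vectors `x 0, …, x (n - 1)` are i.i.d. with law `p`. Given `x`, the sensors in
`H` draw their messages independently, sensor `i` from the law `W i` at its own sequence, and,
independently of these draws, the traitors draw theirs jointly from the law `T x`. -/
def errorProb (p : (∀ i, 𝒳 i) → ℝ) {n : ℕ} {R : Fin m → ℝ}
    (W : ∀ i, (Fin n → 𝒳 i) → Fin (numMsg n (R i)) → ℝ)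
    (g : Msgs n R → ∀ i, Fin n → 𝒳 i) (H : Finset (Fin m))
    (T : (Fin n → ∀ i, 𝒳 i) → Msgs n R → ℝ) : ℝ :=
  ∑ x : Fin n → ∀ i, 𝒳 i, ∑ u : Msgs n R, ∑ a : Msgs n R,
    if ∀ i ∈ H, g (received H u a) i = fun k => x k i then 0
    else (∏ k, p (x k)) * (∏ i, W i (fun k => x k i) (u i)) * T x a

/-- With at most `t` traitors, whoever they are and whatever (possibly randomized) function of all
the source sequences they use, the error probability is at most `ε`. -/
def Resists (p : (∀ i, 𝒳 i) → ℝ) (t : ℕ) (ε : ℝ) {n : ℕ} {R : Fin m → ℝ}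
    (W : ∀ i, (Fin n → 𝒳 i) → Fin (numMsg n (R i)) → ℝ)
    (g : Msgs n R → ∀ i, Fin n → 𝒳 i) : Prop :=
  ∀ H : Finset (Fin m), Hᶜ.card ≤ t →
    ∀ T : (Fin n → ∀ i, 𝒳 i) → Msgs n R → ℝ, (∀ x, T x ∈ stdSimplex ℝ (Msgs n R)) →
      errorProb p W g H T ≤ ε

/-- The deterministic-fixed-rate achievable rate vectors. -/
def detAchievable (p : (∀ i, 𝒳 i) → ℝ) (t : ℕ) : Set (Fin m → ℝ) :=
  {R | ∀ ε > 0, ∀ᶠ n : ℕ in atTop,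
    ∃ (f : ∀ i, (Fin n → 𝒳 i) → Fin (numMsg n (R i))) (g : Msgs n R → ∀ i, Fin n → 𝒳 i),
      Resists p t ε (fun i s => Pi.single (f i s) 1) g}

/-- The randomized-fixed-rate achievable rate vectors: each sensor chooses its message from a
probability distribution that depends on its source sequence. -/
def randAchievable (p : (∀ i, 𝒳 i) → ℝ) (t : ℕ) : Set (Fin m → ℝ) :=
  {R | ∀ ε > 0, ∀ᶠ n : ℕ in atTop,
    ∃ (W : ∀ i, (Fin n → 𝒳 i) → Fin (numMsg n (R i)) → ℝ) (g : Msgs n R → ∀ i, Fin n → 𝒳 i),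
      (∀ i s, W i s ∈ stdSimplex ℝ (Fin (numMsg n (R i)))) ∧ Resists p t ε W g}

end ByzantineSource

end

/-! Both converses extract an injectivity from the decoder. In the randomized case, let the sensors
outside a set `s` of size `m - t` send one fixed message. Averaging (`exists_deterministic_le`)
gives deterministic encoders that do no worse against it, and on the success event their messages
from `s` determine `x_s`. Counting then yields the Slepian–Wolf inequalities
(`condEntropy_le_of_injOn`). In the deterministic case let `s` have size `max 1 (m - 2 * t)`, so
that its complement splits into two sets of at most `t` sensors. If `x` and `y` have equal messages
on `s`, then `x` with one half imitating `y` and `y` with the other half imitating `x` produce the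
same received vector. A decoder that is right in both situations forces `x_s = y_s`.

For achievability the regions are closed, so rates with a margin `δ` suffice
(`closure_eq_rateRegion`). The encoders are random bins. To estimate sequence `i`, the decoder takes
any set `S ∋ i` of `m - t` sensors and any tuple that is typical on `S` and fits the received bins
there. If the true tuple is typical, it is a candidate on a set of honest sensors, so an error needs
a wrong candidate.

Without randomness, a wrong candidate shares its bins with the truth on `S ∩ H`, which has at least
`m - 2 * t` elements, and a good codebook makes this unlikely (`exists_codebook`).

With randomness, each sensor also sends a seed from a group of constant size `C`, which selects its
binning. The traitors fix seeds and bins on `U = S \ H` without knowing the honest seeds, so the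
constraints on all of `S` count. One codebook must face exponentially many sources and traitor bins.
A collision at one seed is only as unlikely as `δ` permits, but collisions at `r` different seeds
have essentially the `r`-th power of that probability (`card_forall_exists_rival_le`). A constant
`r` therefore beats the union bound (`exists_robust`). Then at most the fraction `r / C` of the
honest seeds is bad for each pair of a set and an error pattern (`Robust.card_le`). -/

noncomputable section

namespace ByzantineSource

/-! ### Block probabilities and the weak law of large numbers. -/

section Block

variable {α : Type*} [Fintype α]

open Classical in
/-- The probability of `E` under the `n`-fold power of the weights `p`. -/
def blockProb (p : α → ℝ) {n : ℕ} (E : (Fin n → α) → Prop) : ℝ :=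
  ∑ x with E x, ∏ k, p (x k)

variable {p : α → ℝ} {n : ℕ} {E F : (Fin n → α) → Prop}

lemma blockProb_eq_sum_ite (p : α → ℝ) (E : (Fin n → α) → Prop) [DecidablePred E] :
    blockProb p E = ∑ x, if E x then ∏ k, p (x k) else 0 := by
  classical
  rw [blockProb, Finset.sum_filter]
  exact Finset.sum_congr rfl fun x _ => by congr

omit [Fintype α] in
lemma prod_block_nonneg (hp : ∀ a, 0 ≤ p a) (x : Fin n → α) : 0 ≤ ∏ k, p (x k) :=
  Finset.prod_nonneg fun k _ => hp (x k)

lemma sum_prod_block (h1 : ∑ a, p a = 1) (n : ℕ) : ∑ x : Fin n → α, ∏ k, p (x k) = 1 := by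
  classical
  rw [← Fintype.prod_sum (fun _ a => p a)]
  simp [h1]

lemma blockProb_nonneg (hp : ∀ a, 0 ≤ p a) : 0 ≤ blockProb p E :=
  Finset.sum_nonneg fun x _ => prod_block_nonneg hp x

lemma blockProb_mono (hp : ∀ a, 0 ≤ p a) (h : ∀ x, E x → F x) : blockProb p E ≤ blockProb p F := by
  classical
  refine Finset.sum_le_sum_of_subset_of_nonneg (fun x hx => ?_) fun x _ _ => prod_block_nonneg hp x
  simp only [Finset.mem_filter, Finset.mem_univ, true_and] at hx ⊢
  exact h x hx

lemma blockProb_or_le (hp : ∀ a, 0 ≤ p a) :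
    blockProb p (fun x => E x ∨ F x) ≤ blockProb p E + blockProb p F := by
  classical
  simp only [blockProb_eq_sum_ite]
  rw [← Finset.sum_add_distrib]
  refine Finset.sum_le_sum fun x _ => ?_
  have := prod_block_nonneg hp x
  split_ifs <;> first | linarith | tauto

lemma blockProb_not (h1 : ∑ a, p a = 1) : blockProb p (fun x => ¬ E x) = 1 - blockProb p E := by
  classical
  rw [← sum_prod_block h1 n]
  simp only [blockProb_eq_sum_ite]
  rw [← Finset.sum_sub_distrib]
  refine Finset.sum_congr rfl fun x _ => ?_
  split_ifs <;> simp

lemma blockProb_exists_le {ι : Type*} (s : Finset ι) (E : ι → (Fin n → α) → Prop)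
    (hp : ∀ a, 0 ≤ p a) :
    blockProb p (fun x => ∃ i ∈ s, E i x) ≤ ∑ i ∈ s, blockProb p (E i) := by
  classical
  induction s using Finset.induction_on with
  | empty => simp [blockProb]
  | insert a s ha ih =>
    rw [Finset.sum_insert ha]
    refine le_trans (blockProb_mono hp (F := fun x => E a x ∨ ∃ i ∈ s, E i x) fun x hx => ?_)
      ((blockProb_or_le hp).trans (by linarith))
    simpa using hx

lemma sum_block_succ (f : (Fin (n + 1) → α) → ℝ) :
    ∑ x, f x = ∑ a, ∑ y : Fin n → α, f (Fin.cons a y) := by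
  rw [← Fintype.sum_prod_type']
  exact (Fintype.sum_equiv (Fin.consEquiv fun _ => α) _ _ fun _ => rfl).symm

lemma sum_block_sum (h1 : ∑ a, p a = 1) (ψ : α → ℝ) (h0 : ∑ a, p a * ψ a = 0) (n : ℕ) :
    ∑ x : Fin n → α, (∏ k, p (x k)) * ∑ k, ψ (x k) = 0 := by
  induction n with
  | zero => simp
  | succ n ih =>
    rw [sum_block_succ]
    simp only [Fin.prod_univ_succ, Fin.sum_univ_succ, Fin.cons_zero, Fin.cons_succ]
    have : ∀ a, ∑ y : Fin n → α, p a * (∏ k, p (y k)) * (ψ a + ∑ k, ψ (y k)) =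
        p a * ψ a * ∑ y : Fin n → α, ∏ k, p (y k) +
          p a * ∑ y : Fin n → α, (∏ k, p (y k)) * ∑ k, ψ (y k) := by
      intro a
      rw [Finset.mul_sum, Finset.mul_sum, ← Finset.sum_add_distrib]
      exact Finset.sum_congr rfl fun y _ => by ring
    simp only [this, ih, sum_prod_block h1, mul_one, mul_zero, add_zero, h0]

lemma sum_block_sq_sum (h1 : ∑ a, p a = 1) (ψ : α → ℝ) (h0 : ∑ a, p a * ψ a = 0) (n : ℕ) :
    ∑ x : Fin n → α, (∏ k, p (x k)) * (∑ k, ψ (x k)) ^ 2 = n * ∑ a, p a * ψ a ^ 2 := by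
  induction n with
  | zero => simp
  | succ n ih =>
    rw [sum_block_succ]
    simp only [Fin.prod_univ_succ, Fin.sum_univ_succ, Fin.cons_zero, Fin.cons_succ]
    have : ∀ a, ∑ y : Fin n → α, p a * (∏ k, p (y k)) * (ψ a + ∑ k, ψ (y k)) ^ 2 =
        p a * ψ a ^ 2 * ∑ y : Fin n → α, ∏ k, p (y k) +
          2 * (p a * ψ a) * ∑ y : Fin n → α, (∏ k, p (y k)) * ∑ k, ψ (y k) +
          p a * ∑ y : Fin n → α, (∏ k, p (y k)) * (∑ k, ψ (y k)) ^ 2 := by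
      intro a
      simp only [Finset.mul_sum (s := Finset.univ (α := Fin n → α)), ← Finset.sum_add_distrib]
      exact Finset.sum_congr rfl fun y _ => by ring
    simp only [this, ih, sum_prod_block h1, sum_block_sum h1 ψ h0, mul_one, mul_zero, add_zero]
    rw [Finset.sum_add_distrib, ← Finset.sum_mul, h1]
    push_cast
    ring

/-- Chebyshev's inequality for an i.i.d. sum. -/
lemma blockProb_deviation_le (hp : ∀ a, 0 ≤ p a) (h1 : ∑ a, p a = 1) (φ : α → ℝ) {δ : ℝ}
    (hδ : 0 < δ) (hn : 0 < n) :
    blockProb p (fun x : Fin n → α => n * δ < |∑ k, φ (x k) - n * ∑ a, p a * φ a|) ≤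
      (∑ a, p a * (φ a - ∑ b, p b * φ b) ^ 2) / δ ^ 2 / n := by
  classical
  set μ := ∑ a, p a * φ a with hμ
  have h0 : ∑ a, p a * (φ a - μ) = 0 := by
    simp only [mul_sub, Finset.sum_sub_distrib, ← Finset.sum_mul, h1]
    rw [hμ]; ring
  have hv := sum_block_sq_sum h1 (fun a => φ a - μ) h0 n
  have hn' : (0 : ℝ) < n := by exact_mod_cast hn
  rw [div_div, le_div_iff₀ (by positivity)]
  have key : blockProb p (fun x : Fin n → α => n * δ < |∑ k, φ (x k) - n * μ|) * (n * δ) ^ 2 ≤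
      n * ∑ a, p a * (φ a - μ) ^ 2 := by
    rw [← hv, blockProb_eq_sum_ite, Finset.sum_mul]
    refine Finset.sum_le_sum fun x _ => ?_
    have hx := prod_block_nonneg hp x
    have hs : ∑ k, (φ (x k) - μ) = ∑ k, φ (x k) - n * μ := by simp
    rw [hs]
    split_ifs with h
    · refine mul_le_mul_of_nonneg_left ?_ hx
      rw [← sq_abs (∑ k, φ (x k) - n * μ)]
      exact pow_le_pow_left₀ (by positivity) h.le 2
    · rw [zero_mul]; positivity
  have h2 : blockProb p (fun x : Fin n → α => n * δ < |∑ k, φ (x k) - n * μ|) * (δ ^ 2 * n) * n ≤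
      (∑ a, p a * (φ a - μ) ^ 2) * n := by
    calc _ = _ := by ring
      _ ≤ _ := key
      _ = _ := by ring
  exact le_of_mul_le_mul_right h2 hn'

/-- The weak law of large numbers for a finite alphabet. -/
lemma tendsto_blockProb_deviation (hp : ∀ a, 0 ≤ p a) (h1 : ∑ a, p a = 1) (φ : α → ℝ) {δ : ℝ}
    (hδ : 0 < δ) :
    Tendsto (fun n : ℕ => blockProb p
      (fun x : Fin n → α => n * δ < |∑ k, φ (x k) - n * ∑ a, p a * φ a|)) atTop (𝓝 0) := by
  refine tendsto_of_tendsto_of_tendsto_of_le_of_le' tendsto_const_nhds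
    (tendsto_const_div_atTop_nhds_zero_nat
      ((∑ a, p a * (φ a - ∑ b, p b * φ b) ^ 2) / δ ^ 2)) ?_ ?_
  · exact Eventually.of_forall fun n => blockProb_nonneg hp
  · filter_upwards [eventually_gt_atTop 0] with n hn
    exact blockProb_deviation_le hp h1 φ hδ hn

end Block

/-! ### Conditional probabilities, equipartition and typicality. -/

section Marginal

variable {m : ℕ} {𝒳 : Fin m → Type*} [∀ i, Fintype (𝒳 i)] [∀ i, DecidableEq (𝒳 i)]
  {p : (∀ i, 𝒳 i) → ℝ}

lemma marginal_nonneg (hp : ∀ x, 0 ≤ p x) (A : Finset (Fin m)) (x : ∀ i, 𝒳 i) :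
    0 ≤ marginal p A x := Finset.sum_nonneg fun y _ => hp y

lemma marginal_anti (hp : ∀ x, 0 ≤ p x) {A B : Finset (Fin m)} (h : A ⊆ B) (x : ∀ i, 𝒳 i) :
    marginal p B x ≤ marginal p A x := by
  refine Finset.sum_le_sum_of_subset_of_nonneg (fun y hy => ?_) fun y _ _ => hp y
  simp only [Finset.mem_filter, Finset.mem_univ, true_and] at hy ⊢
  exact fun i hi => hy i (h hi)

lemma le_marginal (hp : ∀ x, 0 ≤ p x) (A : Finset (Fin m)) (x : ∀ i, 𝒳 i) :
    p x ≤ marginal p A x :=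
  Finset.single_le_sum (f := p) (fun y _ => hp y) (by simp)

lemma marginal_congr {A : Finset (Fin m)} {x y : ∀ i, 𝒳 i} (h : ∀ i ∈ A, x i = y i) :
    marginal p A x = marginal p A y := by
  unfold marginal
  congr 1
  ext z
  simp only [Finset.mem_filter, Finset.mem_univ, true_and]
  exact forall₂_congr fun i hi => by rw [h i hi]

/-- The conditional probability `p(x_A | x_B)`. -/
def condProb (p : (∀ i, 𝒳 i) → ℝ) (A B : Finset (Fin m)) (x : ∀ i, 𝒳 i) : ℝ :=
  marginal p (A ∪ B) x / marginal p B x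

lemma condProb_nonneg (hp : ∀ x, 0 ≤ p x) (A B : Finset (Fin m)) (x : ∀ i, 𝒳 i) :
    0 ≤ condProb p A B x := div_nonneg (marginal_nonneg hp _ x) (marginal_nonneg hp _ x)

lemma condProb_le_one (hp : ∀ x, 0 ≤ p x) (A B : Finset (Fin m)) (x : ∀ i, 𝒳 i) :
    condProb p A B x ≤ 1 :=
  div_le_one_of_le₀ (marginal_anti hp Finset.subset_union_right x) (marginal_nonneg hp _ x)

lemma condProb_pos (hp : ∀ x, 0 ≤ p x) (A B : Finset (Fin m)) {x : ∀ i, 𝒳 i} (hx : 0 < p x) :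
    0 < condProb p A B x :=
  div_pos (hx.trans_le (le_marginal hp _ x)) (hx.trans_le (le_marginal hp _ x))

lemma condProb_congr {A B : Finset (Fin m)} {x y : ∀ i, 𝒳 i} (h : ∀ i ∈ A ∪ B, x i = y i) :
    condProb p A B x = condProb p A B y := by
  rw [condProb, condProb, marginal_congr h,
    marginal_congr fun i hi => h i (Finset.mem_union_right A hi)]

lemma condEntropy_nonneg (hp : ∀ x, 0 ≤ p x) (A B : Finset (Fin m)) : 0 ≤ condEntropy p A B :=
  Finset.sum_nonneg fun x _ => mul_nonneg (hp x) <| neg_nonneg.2 <|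
    Real.logb_nonpos one_lt_two (condProb_nonneg hp A B x) (condProb_le_one hp A B x)

lemma prod_eq_rpow_of_pos {n : ℕ} {f : Fin n → ℝ} (hf : ∀ k, 0 < f k) :
    ∏ k, f k = (2 : ℝ) ^ (-∑ k, -Real.logb 2 (f k)) := by
  rw [Finset.sum_neg_distrib, neg_neg, Real.rpow_sum_of_pos two_pos]
  exact Finset.prod_congr rfl fun k _ =>
    (Real.rpow_logb two_pos (by norm_num) (hf k)).symm

/-- The asymptotic equipartition property for conditional probabilities. -/
lemma tendsto_blockProb_condProb (hp : ∀ x, 0 ≤ p x) (h1 : ∑ x, p x = 1) (A B : Finset (Fin m))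
    {δ : ℝ} (hδ : 0 < δ) :
    Tendsto (fun n : ℕ => blockProb p (fun x : Fin n → ∀ i, 𝒳 i =>
      ¬ ((2 : ℝ) ^ (-(n * (condEntropy p A B + δ))) ≤ ∏ k, condProb p A B (x k) ∧
        ∏ k, condProb p A B (x k) ≤ (2 : ℝ) ^ (-(n * (condEntropy p A B - δ)))))) atTop (𝓝 0) := by
  classical
  refine tendsto_of_tendsto_of_tendsto_of_le_of_le tendsto_const_nhds
    (tendsto_blockProb_deviation hp h1 (fun x => -Real.logb 2 (condProb p A B x)) hδ)
    (fun n => blockProb_nonneg hp) (fun n => ?_)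
  simp only [blockProb_eq_sum_ite]
  refine Finset.sum_le_sum fun x _ => ?_
  by_cases hx : ∀ k, 0 < p (x k)
  · have hpr := prod_eq_rpow_of_pos fun k => condProb_pos hp A B (hx k)
    have hx0 := prod_block_nonneg hp x
    rw [hpr]
    have hH : condEntropy p A B = ∑ a, p a * -Real.logb 2 (condProb p A B a) := rfl
    rw [← hH]
    by_cases h' : n * δ < |∑ k, -Real.logb 2 (condProb p A B (x k)) - n * condEntropy p A B|
    · rw [if_pos h']
      split_ifs
      · exact hx0
      · exact le_rfl
    · rw [if_neg h', if_neg]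
      have := abs_le.1 (not_lt.1 h')
      refine not_not.2 ⟨?_, ?_⟩ <;>
      · refine Real.rpow_le_rpow_of_exponent_le one_le_two ?_
        linarith [this.1, this.2]
  -- A block with a letter of probability zero may violate the bounds, but it has weight zero.
  · push Not at hx
    obtain ⟨k, hk⟩ := hx
    have : ∏ k, p (x k) = 0 := Finset.prod_eq_zero (Finset.mem_univ k) (le_antisymm hk (hp _))
    simp [this]

/-- The block marginal is the product of the marginals. -/
lemma blockProb_agree (p : (∀ i, 𝒳 i) → ℝ) {n : ℕ} (B : Finset (Fin m)) (z : Fin n → ∀ i, 𝒳 i) :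
    blockProb p (fun x => ∀ k, ∀ i ∈ B, x k i = z k i) = ∏ k, marginal p B (z k) := by
  classical
  unfold marginal
  rw [Finset.prod_univ_sum]
  unfold blockProb
  refine Finset.sum_congr ?_ fun _ _ => rfl
  ext x
  simp [Fintype.mem_piFinset]

lemma sum_marginal_le (hp : ∀ x, 0 ≤ p x) {D S : Finset (Fin m)} (hD : D ⊆ S) (z : ∀ i, 𝒳 i) :
    ∑ y with ∀ i ∉ D, y i = z i, marginal p S y ≤ marginal p (S \ D) z := by
  classical
  unfold marginal
  simp only [Finset.sum_filter (s := Finset.univ)]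
  rw [← Finset.sum_filter, Finset.sum_comm]
  refine Finset.sum_le_sum fun w _ => ?_
  by_cases hw : ∀ i ∈ S \ D, w i = z i
  · rw [if_pos hw, ← Finset.sum_filter, Finset.sum_const, nsmul_eq_mul]
    refine mul_le_of_le_one_left (hp w) ?_
    -- Each `w` is counted at most once: such a `y` copies `w` on `D` and `z` elsewhere.
    rw [Nat.cast_le_one, Finset.card_le_one]
    simp only [Finset.mem_filter, Finset.mem_univ, true_and]
    rintro a ⟨ha, ha'⟩ b ⟨hb, hb'⟩
    funext i
    by_cases hi : i ∈ D
    · rw [← ha' i (hD hi), ← hb' i (hD hi)]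
    · rw [ha i hi, hb i hi]
  · rw [if_neg hw]
    refine (Finset.sum_eq_zero fun y hy => if_neg fun h => hw fun i hi => ?_).le
    simp only [Finset.mem_filter, Finset.mem_univ, true_and] at hy
    rw [Finset.mem_sdiff] at hi
    rw [h i hi.1, hy i hi.2]

/-- For fixed `x_{Dᶜ}`, few values `x_D` have a conditional probability that is not small. -/
lemma card_condProb_ge_le (hp : ∀ x, 0 ≤ p x) {D S : Finset (Fin m)} (hD : D ⊆ S) {n : ℕ}
    (z : Fin n → ∀ i, 𝒳 i) (θ : ℝ) (T : Finset (Fin n → ∀ i, 𝒳 i))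
    (hT : ∀ x ∈ T, (∀ k, ∀ i ∉ D, x k i = z k i) ∧ θ ≤ ∏ k, condProb p D (S \ D) (x k)) :
    (T.card : ℝ) * θ ≤ 1 := by
  classical
  have h1 : ∀ k, ∑ y with ∀ i ∉ D, y i = z k i, condProb p D (S \ D) y ≤ 1 := by
    intro k
    have : ∀ y ∈ Finset.univ.filter (fun y : ∀ i, 𝒳 i => ∀ i ∉ D, y i = z k i),
        condProb p D (S \ D) y = marginal p S y / marginal p (S \ D) (z k) := by
      intro y hy
      simp only [Finset.mem_filter, Finset.mem_univ, true_and] at hy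
      rw [condProb, Finset.union_sdiff_of_subset hD,
        marginal_congr fun i hi => hy i (Finset.mem_sdiff.1 hi).2]
    rw [Finset.sum_congr rfl this, ← Finset.sum_div]
    exact div_le_one_of_le₀ (sum_marginal_le hp hD (z k)) (marginal_nonneg hp _ _)
  calc (T.card : ℝ) * θ = ∑ x ∈ T, θ := by simp
    _ ≤ ∑ x ∈ T, ∏ k, condProb p D (S \ D) (x k) := Finset.sum_le_sum fun x hx => (hT x hx).2
    _ ≤ ∑ x ∈ Fintype.piFinset fun k => Finset.univ.filter fun y => ∀ i ∉ D, y i = z k i,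
          ∏ k, condProb p D (S \ D) (x k) := by
        refine Finset.sum_le_sum_of_subset_of_nonneg (fun x hx => ?_) fun x _ _ =>
          Finset.prod_nonneg fun k _ => condProb_nonneg hp _ _ _
        simpa [Fintype.mem_piFinset] using (hT x hx).1
    _ = ∏ k, ∑ y with ∀ i ∉ D, y i = z k i, condProb p D (S \ D) y :=
        (Finset.prod_univ_sum _ _).symm
    _ ≤ 1 := Finset.prod_le_one (fun k _ => Finset.sum_nonneg fun y _ => condProb_nonneg hp _ _ _)
        fun k _ => h1 k

/-- The sequences whose restrictions to subsets of `S` are conditionally typical. -/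
def Typ (p : (∀ i, 𝒳 i) → ℝ) (δ : ℝ) (S : Finset (Fin m)) {n : ℕ} (x : Fin n → ∀ i, 𝒳 i) : Prop :=
  ∀ s ⊆ S, ∀ D ⊆ s, (2 : ℝ) ^ (-(n * (condEntropy p D (s \ D) + δ))) ≤
    ∏ k, condProb p D (s \ D) (x k)

lemma Typ.mono {δ : ℝ} {s S : Finset (Fin m)} (h : s ⊆ S) {n : ℕ} {x : Fin n → ∀ i, 𝒳 i}
    (hx : Typ p δ S x) : Typ p δ s x := fun s' hs' => hx s' (hs'.trans h)

lemma Typ.congr {δ : ℝ} {S : Finset (Fin m)} {n : ℕ} {x y : Fin n → ∀ i, 𝒳 i}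
    (h : ∀ k, ∀ i ∈ S, x k i = y k i) (hx : Typ p δ S x) : Typ p δ S y := by
  intro s hs D hD
  refine (hx s hs D hD).trans (Finset.prod_congr rfl fun k _ => condProb_congr fun i hi => ?_).le
  rw [Finset.union_sdiff_of_subset hD] at hi
  exact h k i (hs hi)

lemma card_typ_le (hp : ∀ x, 0 ≤ p x) {D S : Finset (Fin m)} (hD : D ⊆ S) {n : ℕ} {δ : ℝ}
    (z : Fin n → ∀ i, 𝒳 i) (T : Finset (Fin n → ∀ i, 𝒳 i))
    (hT : ∀ x ∈ T, (∀ k, ∀ i ∉ D, x k i = z k i) ∧ Typ p δ S x) :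
    (T.card : ℝ) ≤ (2 : ℝ) ^ (n * (condEntropy p D (S \ D) + δ)) := by
  have := card_condProb_ge_le hp hD z _ T fun x hx => ⟨(hT x hx).1, (hT x hx).2 S le_rfl D hD⟩
  rwa [Real.rpow_neg zero_le_two, ← div_eq_mul_inv, div_le_one (by positivity)] at this

lemma tendsto_blockProb_not_typ (hp : ∀ x, 0 ≤ p x) (h1 : ∑ x, p x = 1) {δ : ℝ} (hδ : 0 < δ) :
    Tendsto (fun n : ℕ => blockProb p (fun x : Fin n → ∀ i, 𝒳 i => ¬ Typ p δ Finset.univ x))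
      atTop (𝓝 0) := by
  have hsum := tendsto_finsetSum (Finset.univ : Finset (Finset (Fin m) × Finset (Fin m)))
    fun DB _ => tendsto_blockProb_condProb hp h1 DB.1 (DB.2 \ DB.1) hδ
  rw [Finset.sum_const_zero] at hsum
  refine tendsto_of_tendsto_of_tendsto_of_le_of_le tendsto_const_nhds hsum
    (fun n => blockProb_nonneg hp) (fun n => ?_)
  refine le_trans (blockProb_mono hp fun x hx => ?_) (blockProb_exists_le _ _ hp)
  simp only [Typ] at hx
  push Not at hx
  obtain ⟨s, -, D, -, h⟩ := hx
  exact ⟨(D, s), Finset.mem_univ _, fun h' => h.not_ge h'.1⟩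

end Marginal

end ByzantineSource

namespace ByzantineSource

/-! ### Random binning, by counting codebooks. -/

section Binning

open Classical in
/-- Requiring the entries of a function on `D` to be equal to quantities that depend only on its
entries outside `D` cuts down the number of functions by the factor `∏ k ∈ D, card (V k)`. -/
lemma card_filter_mul_prod_le {K : Type*} [Fintype K] [DecidableEq K] {V : K → Type*} [∀ k, Fintype (V k)]
    (D : Finset K) (P : (∀ k, V k) → Prop) (h : (∀ k, V k) → ∀ k, V k)
    (hP : ∀ F F' : ∀ k, V k, (∀ k ∉ D, F k = F' k) → P F → P F')
    (hh : ∀ F F' : ∀ k, V k, (∀ k ∉ D, F k = F' k) → ∀ k ∈ D, h F k = h F' k) :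
    (Finset.univ.filter fun F => P F ∧ ∀ k ∈ D, F k = h F k).card * ∏ k ∈ D, Fintype.card (V k) ≤
      (Finset.univ.filter P).card := by
  have hc : ∏ k ∈ D, Fintype.card (V k) = (Finset.univ : Finset (∀ k : D, V k)).card := by
    rw [Finset.card_univ, Fintype.card_pi, Finset.prod_coe_sort D fun k => Fintype.card (V k)]
  rw [hc, ← Finset.card_product]
  -- Overwriting the entries on `D` by `v` loses nothing: the old ones equal `h F`, which the
  -- entries off `D` determine.
  refine Finset.card_le_card_of_injOn
    (fun Fv k => if hk : k ∈ D then Fv.2 ⟨k, hk⟩ else Fv.1 k) ?_ ?_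
  · rintro ⟨F, v⟩ hF
    simp only [Finset.coe_product, Finset.coe_filter, Finset.coe_univ, Set.mem_prod,
      Set.mem_ofPred_eq, Finset.mem_univ, true_and] at hF ⊢
    exact hP F _ (fun k hk => by simp [hk]) hF.1.1
  · rintro ⟨F, v⟩ hF ⟨F', v'⟩ hF' heq
    simp only [Finset.coe_product, Finset.coe_filter, Finset.coe_univ, Set.mem_prod,
      Set.mem_ofPred_eq, Finset.mem_univ, true_and] at hF hF'
    have hoff : ∀ k ∉ D, F k = F' k := fun k hk => by simpa [hk] using congrFun heq k
    have hF2 : F = F' := by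
      funext k
      by_cases hk : k ∈ D
      · rw [hF.1.2 k hk, hF'.1.2 k hk, hh F F' hoff k hk]
      · exact hoff k hk
    have hv : v = v' := by
      funext k
      simpa using congrFun heq k
    rw [hF2, hv]

variable {ι : Type*} [Fintype ι] [DecidableEq ι] {𝒴 : ι → Type*} [∀ i, Fintype (𝒴 i)]
  [∀ i, DecidableEq (𝒴 i)] {κ : Type*} [Fintype κ] [DecidableEq κ] {N : ι → ℕ}

/-- For each sensor `i` and each seed, a map from the source sequences to `N i` bins. -/
abbrev Codebook (κ : Type*) (𝒴 : ι → Type*) (N : ι → ℕ) : Type _ :=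
  ∀ k : (Σ i, κ × 𝒴 i), Fin (N k.1)

/-- With seeds `c`, the sequences `y` fall into the bins of `x` on `A` and into the bins `b`
on `U`. -/
def Collides (F : Codebook κ 𝒴 N) (A U : Finset ι) (x : ∀ i, 𝒴 i) (b : ∀ i, Fin (N i)) (c : ι → κ)
    (y : ∀ i, 𝒴 i) : Prop :=
  (∀ i ∈ A, F ⟨i, c i, y i⟩ = F ⟨i, c i, x i⟩) ∧ ∀ i ∈ U, F ⟨i, c i, y i⟩ = b i

/-- The tuples in `T` that are different from `x` at all places in `A` and equal to `x` at the
places outside `A ∪ U`. -/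
def Rival (T : Finset (∀ i, 𝒴 i)) (A U : Finset ι) (x y : ∀ i, 𝒴 i) : Prop :=
  y ∈ T ∧ (∀ i ∉ A ∪ U, y i = x i) ∧ ∀ i ∈ A, y i ≠ x i

variable {A U : Finset ι} {x : ∀ i, 𝒴 i} {b : ∀ i, Fin (N i)} {T : Finset (∀ i, 𝒴 i)}

-- The entries at `(i, c' i, y i)` with `i ∈ D` play no role in the earlier collisions: on `A` the
-- seed is new, and on `D ∩ U` the sequence is new. The bins of `x` on `A` do not involve them
-- either, because `y` differs from `x` there.
open Classical in
lemma card_collides_mul_le {r : ℕ} (c : Fin r → ι → κ) (c' : ι → κ)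
    (hcA : ∀ i ∈ A, ∀ j, c' i ≠ c j i) (ys : Fin r → ∀ i, 𝒴 i) (y : ∀ i, 𝒴 i)
    (hy : ∀ i ∈ A, y i ≠ x i) {D : Finset ι} (hDU : D ⊆ A ∪ U)
    (hfresh : ∀ i ∈ D, i ∈ U → ∀ j, y i ≠ ys j i) :
    (Finset.univ.filter fun F : Codebook κ 𝒴 N =>
        (∀ j, Collides F A U x b (c j) (ys j)) ∧ Collides F A U x b c' y).card * ∏ i ∈ D, N i ≤
      (Finset.univ.filter fun F : Codebook κ 𝒴 N =>
        ∀ j, Collides F A U x b (c j) (ys j)).card := by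
  set E : Finset (Σ i, κ × 𝒴 i) := D.image fun i => ⟨i, c' i, y i⟩ with hE
  have hmem : ∀ i s z, (⟨i, s, z⟩ : Σ i, κ × 𝒴 i) ∈ E ↔ i ∈ D ∧ s = c' i ∧ z = y i := by
    intro i s z
    simp only [hE, Finset.mem_image]
    constructor
    · rintro ⟨i', hi', h⟩
      obtain rfl : i' = i := congrArg Sigma.fst h
      simp only [Sigma.mk.injEq, heq_eq_eq, Prod.mk.injEq, true_and] at h
      exact ⟨hi', h.1.symm, h.2.symm⟩
    · rintro ⟨hi, rfl, rfl⟩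
      exact ⟨i, hi, rfl⟩
  have hprod : ∏ k ∈ E, Fintype.card (Fin (N k.1)) = ∏ i ∈ D, N i := by
    rw [hE, Finset.prod_image fun i _ i' _ h => congrArg Sigma.fst h]
    simp
  have hx : ∀ i ∈ A, ∀ s, (⟨i, s, x i⟩ : Σ i, κ × 𝒴 i) ∉ E := by
    intro i hi s h
    exact hy i hi ((hmem i s _).1 h).2.2.symm
  have main := card_filter_mul_prod_le (V := fun k : (Σ i, κ × 𝒴 i) => Fin (N k.1)) E
    (fun F => ∀ j, Collides F A U x b (c j) (ys j))
    (fun F k => if k.1 ∈ A then F ⟨k.1, k.2.1, x k.1⟩ else b k.1) ?_ ?_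
  · rw [hprod] at main
    refine le_trans (Nat.mul_le_mul_right _ (Finset.card_le_card fun F hF => ?_))
      (main.trans_eq (by congr))
    simp only [Finset.mem_filter, Finset.mem_univ, true_and] at hF ⊢
    refine ⟨hF.1, ?_⟩
    rintro ⟨i, s, z⟩ hk
    obtain ⟨hi, rfl, rfl⟩ := (hmem i s z).1 hk
    by_cases hiA : i ∈ A
    · simpa [hiA] using hF.2.1 i hiA
    · simpa [hiA] using hF.2.2 i ((Finset.mem_union.1 (hDU hi)).resolve_left hiA)
  · intro F F' hFF hF j
    refine ⟨fun i hi => ?_, fun i hi => ?_⟩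
    · rw [← hFF _ (hx i hi _), ← (hF j).1 i hi, hFF]
      exact fun h => hcA i hi j ((hmem _ _ _).1 h).2.1.symm
    · rw [← (hF j).2 i hi, hFF]
      intro h
      obtain ⟨h1, -, h3⟩ := (hmem _ _ _).1 h
      exact hfresh i h1 hi j h3.symm
  · intro F F' hFF k hk
    by_cases hiA : k.1 ∈ A
    · simpa only [hiA, if_true] using hFF _ (hx k.1 hiA k.2.1)
    · simp only [hiA, if_false]

-- Seeds may repeat on `U`, so a rival that reuses a sequence of an earlier rival may meet the
-- prescribed bin for free. Rivals are therefore sorted by the places where they reuse a sequence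
-- and the rival they take it from. For each of the `(r + 1) ^ card ι` patterns, with `D` the set
-- `A` and the fresh places in `U`, there are at most `q * ∏ i ∈ D, N i` rivals, and each collides
-- for at most the fraction `1 / ∏ i ∈ D, N i` of the codebooks.
open Classical in
lemma sum_card_collides_le {r : ℕ} {q : ℝ} (hN : ∀ i, 0 < N i) (hAU : Disjoint A U)
    (hT : ∀ D, A ⊆ D → D ⊆ A ∪ U → ∀ (z : ∀ i, 𝒴 i) (B : Finset (∀ i, 𝒴 i)),
      (∀ y ∈ B, y ∈ T ∧ ∀ i ∉ D, y i = z i) → (B.card : ℝ) ≤ q * ∏ i ∈ D, (N i : ℝ))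
    (c : Fin r → ι → κ) (c' : ι → κ) (hcA : ∀ i ∈ A, ∀ j, c' i ≠ c j i)
    (ys : Fin r → ∀ i, 𝒴 i) :
    ∑ y with Rival T A U x y, ((Finset.univ.filter fun F : Codebook κ 𝒴 N =>
        (∀ j, Collides F A U x b (c j) (ys j)) ∧ Collides F A U x b c' y).card : ℝ) ≤
      ((r + 1 : ℕ) : ℝ) ^ Fintype.card ι * q * (Finset.univ.filter fun F : Codebook κ 𝒴 N =>
        ∀ j, Collides F A U x b (c j) (ys j)).card := by
  set P := ((Finset.univ.filter fun F : Codebook κ 𝒴 N =>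
        ∀ j, Collides F A U x b (c j) (ys j)).card : ℝ) with hP
  -- At a place in `U`, `L y` names an earlier rival with the same entry; `none` means fresh.
  let L : (∀ i, 𝒴 i) → ι → Option (Fin r) := fun y i =>
    if h : i ∈ U ∧ ∃ j, ys j i = y i then some h.2.choose else none
  rw [← Finset.sum_fiberwise _ L]
  have hcard : ((r + 1 : ℕ) : ℝ) ^ Fintype.card ι * q * P =
      ∑ _l : ι → Option (Fin r), q * P := by
    rw [Finset.sum_const, Finset.card_univ, Fintype.card_fun, Fintype.card_option, Fintype.card_fin,
      nsmul_eq_mul]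
    push_cast
    ring
  rw [hcard]
  refine Finset.sum_le_sum fun l _ => ?_
  set D := A ∪ U.filter (fun i => l i = none) with hD
  have hAD : A ⊆ D := Finset.subset_union_left
  have hDU : D ⊆ A ∪ U := Finset.union_subset_union_right (Finset.filter_subset _ _)
  have hpos : (0 : ℝ) < ∏ i ∈ D, (N i : ℝ) :=
    Finset.prod_pos fun i _ => by exact_mod_cast hN i
  have hterm : ∀ y ∈ (Finset.univ.filter fun y => Rival T A U x y).filter (fun y => L y = l),
      ((Finset.univ.filter fun F : Codebook κ 𝒴 N =>
        (∀ j, Collides F A U x b (c j) (ys j)) ∧ Collides F A U x b c' y).card : ℝ) ≤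
        P / ∏ i ∈ D, (N i : ℝ) := by
    intro y hy
    simp only [Finset.mem_filter, Finset.mem_univ, true_and] at hy
    obtain ⟨hy, hl⟩ := hy
    rw [le_div_iff₀ hpos]
    have := card_collides_mul_le (x := x) (b := b) (N := N) c c' hcA ys y hy.2.2 hDU ?_
    · rw [hP]
      exact_mod_cast this
    · intro i hiD hiU j hj
      have hn : l i = none := by
        rcases Finset.mem_union.1 hiD with h | h
        · exact absurd hiU (Finset.disjoint_left.1 hAU h)
        · exact (Finset.mem_filter.1 h).2
      have hh : i ∈ U ∧ ∃ j, ys j i = y i := ⟨hiU, j, hj.symm⟩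
      rw [← hl] at hn
      simp only [L, dif_pos hh] at hn
      exact absurd hn (by simp)
  refine (Finset.sum_le_sum hterm).trans ?_
  rw [Finset.sum_const, nsmul_eq_mul]
  have hsub : ((((Finset.univ.filter fun y => Rival T A U x y).filter
      (fun y => L y = l)).card : ℕ) : ℝ) ≤ q * ∏ i ∈ D, (N i : ℝ) := by
    -- The pattern fixes `y` off `D`: reused entries come from the recorded rival, and those outside
    -- `A ∪ U` from `x`.
    refine hT D hAD hDU (fun i => match l i with
      | some j => ys j i
      | none => x i) _ fun y hy => ?_
    simp only [Finset.mem_filter, Finset.mem_univ, true_and] at hy ⊢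
    obtain ⟨hy, hl⟩ := hy
    refine ⟨hy.1, fun i hi => ?_⟩
    by_cases hh : i ∈ U ∧ ∃ j, ys j i = y i
    · have : l i = some hh.2.choose := by rw [← hl]; simp only [L, dif_pos hh]
      rw [this]
      exact hh.2.choose_spec.symm
    · have hn : l i = none := by rw [← hl]; simp only [L, dif_neg hh]
      rw [hn]
      refine hy.2.1 i fun hiAU => hi ?_
      rcases Finset.mem_union.1 hiAU with h | h
      · exact hAD h
      · exact Finset.mem_union_right _ (Finset.mem_filter.2 ⟨h, hn⟩)
  calc _ ≤ (q * ∏ i ∈ D, (N i : ℝ)) * (P / ∏ i ∈ D, (N i : ℝ)) :=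
        mul_le_mul_of_nonneg_right hsub (div_nonneg (Nat.cast_nonneg _) hpos.le)
    _ = q * P := by field_simp

-- Induction on the number of seeds. `R` bounds that number throughout, so that every step costs the
-- same factor.
open Classical in
lemma sum_tuple_card_collides_le {q : ℝ} (hq : 0 ≤ q) (hN : ∀ i, 0 < N i) (hAU : Disjoint A U)
    (hT : ∀ D, A ⊆ D → D ⊆ A ∪ U → ∀ (z : ∀ i, 𝒴 i) (B : Finset (∀ i, 𝒴 i)),
      (∀ y ∈ B, y ∈ T ∧ ∀ i ∉ D, y i = z i) → (B.card : ℝ) ≤ q * ∏ i ∈ D, (N i : ℝ)) {R r : ℕ}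
    (hr : r ≤ R) (c : Fin r → ι → κ) (hcA : ∀ i ∈ A, Function.Injective fun j => c j i) :
    ∑ ys : Fin r → ∀ i, 𝒴 i with ∀ j, Rival T A U x (ys j),
        ((Finset.univ.filter fun F : Codebook κ 𝒴 N =>
          ∀ j, Collides F A U x b (c j) (ys j)).card : ℝ) ≤
      ((R : ℝ) ^ Fintype.card ι * q) ^ r * Fintype.card (Codebook κ 𝒴 N) := by
  induction r with
  | zero => simp
  | succ r ih =>
    have ih' := ih (Nat.le_of_succ_le hr) (fun j => c j.succ) fun i hi j j' h =>
      Fin.succ_injective _ (hcA i hi h)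
    rw [Finset.sum_filter, sum_block_succ, Finset.sum_comm]
    have hstep : ∀ ys : Fin r → ∀ i, 𝒴 i, ∑ y : ∀ i, 𝒴 i,
        (if ∀ j, Rival T A U x (Fin.cons (α := fun _ => ∀ i, 𝒴 i) y ys j) then
          ((Finset.univ.filter fun F : Codebook κ 𝒴 N => ∀ j, Collides F A U x b (c j)
            (Fin.cons (α := fun _ => ∀ i, 𝒴 i) y ys j)).card : ℝ) else 0) ≤
        (R : ℝ) ^ Fintype.card ι * q * if ∀ j, Rival T A U x (ys j) then
          ((Finset.univ.filter fun F : Codebook κ 𝒴 N =>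
            ∀ j, Collides F A U x b (c j.succ) (ys j)).card : ℝ) else 0 := by
      intro ys
      simp only [Fin.forall_fin_succ, Fin.cons_zero, Fin.cons_succ]
      by_cases hys : ∀ j, Rival T A U x (ys j)
      · simp only [hys, implies_true, and_true, if_true]
        rw [← Finset.sum_filter]
        have := sum_card_collides_le (x := x) (b := b) hN hAU hT (fun j => c j.succ) (c 0)
          (fun i hi j h => (Fin.succ_ne_zero j).symm (hcA i hi h)) ys
        simp only [and_comm (a := Collides _ A U x b (c 0) _)]
        refine this.trans ?_
        have hr' : ((r + 1 : ℕ) : ℝ) ≤ R := by exact_mod_cast hr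
        gcongr
      · simp [hys]
    refine (Finset.sum_le_sum fun ys _ => hstep ys).trans ?_
    rw [← Finset.mul_sum, ← Finset.sum_filter, pow_succ', mul_assoc (_ * q)]
    exact mul_le_mul_of_nonneg_left ih' (by positivity)

open Classical in
/-- The random binning bound: with `r` seeds that are different at all places in `A`, it is
unlikely that for each of them a rival of `x` falls into the bins of `x` on `A` and into
prescribed bins on `U`. -/
lemma card_forall_exists_rival_le {q : ℝ} (hq : 0 ≤ q) (hN : ∀ i, 0 < N i) (hAU : Disjoint A U)
    (hT : ∀ D, A ⊆ D → D ⊆ A ∪ U → ∀ (z : ∀ i, 𝒴 i) (B : Finset (∀ i, 𝒴 i)),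
      (∀ y ∈ B, y ∈ T ∧ ∀ i ∉ D, y i = z i) → (B.card : ℝ) ≤ q * ∏ i ∈ D, (N i : ℝ)) {r : ℕ}
    (c : Fin r → ι → κ) (hcA : ∀ i ∈ A, Function.Injective fun j => c j i) :
    ((Finset.univ.filter fun F : Codebook κ 𝒴 N =>
        ∀ j, ∃ y, Rival T A U x y ∧ Collides F A U x b (c j) y).card : ℝ) ≤
      ((r : ℝ) ^ Fintype.card ι * q) ^ r * Fintype.card (Codebook κ 𝒴 N) := by
  refine le_trans ?_ (sum_tuple_card_collides_le (x := x) (b := b) hq hN hAU hT le_rfl c hcA)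
  rw [← Nat.cast_sum, Nat.cast_le]
  refine le_trans (Finset.card_le_card fun F hF => ?_) Finset.card_biUnion_le
  simp only [Finset.mem_filter, Finset.mem_univ, true_and] at hF
  choose ys h1 h2 using hF
  simp only [Finset.mem_biUnion, Finset.mem_filter, Finset.mem_univ, true_and]
  exact ⟨ys, h1, h2⟩

end Binning

end ByzantineSource

/-! ### Error probabilities, derandomization and the Slepian–Wolf converse. -/

namespace ByzantineSource

/-- A deterministic function does at least as well as random choices that are independent at
different arguments. -/
lemma exists_deterministic_le {ι : Type*} [Fintype ι] [DecidableEq ι] {𝒴 V : ι → Type*}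
    [∀ i, Fintype (𝒴 i)] [∀ i, DecidableEq (𝒴 i)] [∀ i, Fintype (V i)] [∀ i, DecidableEq (V i)]
    (W : ∀ i, 𝒴 i → V i → ℝ) (hW : ∀ i s, W i s ∈ stdSimplex ℝ (V i))
    (Φ : (∀ i, 𝒴 i) → (∀ i, V i) → ℝ) :
    ∃ f : ∀ i, 𝒴 i → V i, ∑ y, Φ y (fun i => f i (y i)) ≤
      ∑ y, ∑ u, (∏ i, W i (y i) (u i)) * Φ y u := by
  by_contra! hcon
  -- The values of a random table are drawn independently; reading one entry per index `i`
  -- reproduces the product of the laws `W i (y i)`.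
  let w : (∀ k : (Σ i, 𝒴 i), V k.1) → ℝ := fun F => ∏ k, W k.1 k.2 (F k)
  have hw0 : ∀ F, 0 ≤ w F := fun F => Finset.prod_nonneg fun k _ => (hW k.1 k.2).1 _
  have hw1 : ∑ F, w F = 1 := by
    simp only [w]
    rw [← Fintype.prod_sum (fun (k : Σ i, 𝒴 i) v => W k.1 k.2 v)]
    exact Finset.prod_eq_one fun k _ => (hW k.1 k.2).2
  have hmarg : ∀ (y : ∀ i, 𝒴 i) (u : ∀ i, V i),
      ∑ F with (fun i => F ⟨i, y i⟩) = u, w F = ∏ i, W i (y i) (u i) := by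
    intro y u
    have hset : (Finset.univ.filter fun F : (∀ k : (Σ i, 𝒴 i), V k.1) =>
        (fun i => F ⟨i, y i⟩) = u) =
        Fintype.piFinset fun k : (Σ i, 𝒴 i) => if k.2 = y k.1 then {u k.1} else Finset.univ := by
      ext F
      simp only [Finset.mem_filter, Finset.mem_univ, true_and, Fintype.mem_piFinset]
      constructor
      · rintro rfl ⟨i, s⟩
        by_cases h : s = y i
        · subst h; simp
        · simp [h]
      · intro h
        funext i
        simpa using h ⟨i, y i⟩
    rw [hset, ← Finset.prod_univ_sum _ (fun (k : Σ i, 𝒴 i) v => W k.1 k.2 v), Fintype.prod_sigma]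
    refine Finset.prod_congr rfl fun i _ => ?_
    rw [Finset.prod_eq_single (y i)]
    · simp
    · intro s _ hs
      simp only [hs, if_false]
      exact (hW i s).2
    · simp
  have havg : ∑ F, w F * ∑ y, Φ y (fun i => F ⟨i, y i⟩) =
      ∑ y, ∑ u, (∏ i, W i (y i) (u i)) * Φ y u := by
    simp only [Finset.mul_sum]
    rw [Finset.sum_comm]
    refine Finset.sum_congr rfl fun y _ => ?_
    rw [← Finset.sum_fiberwise _ (fun F : (∀ k : (Σ i, 𝒴 i), V k.1) => fun i => F ⟨i, y i⟩)]
    refine Finset.sum_congr rfl fun u _ => ?_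
    rw [← hmarg, Finset.sum_mul]
    refine Finset.sum_congr rfl fun F hF => ?_
    rw [(Finset.mem_filter.1 hF).2]
  set c := ∑ y, ∑ u, (∏ i, W i (y i) (u i)) * Φ y u with hc
  have hne : ∃ F ∈ (Finset.univ : Finset (∀ k : (Σ i, 𝒴 i), V k.1)), w F ≠ 0 :=
    Finset.exists_ne_zero_of_sum_ne_zero (by rw [hw1]; exact one_ne_zero)
  have : ∑ F, w F * c < ∑ F, w F * ∑ y, Φ y (fun i => F ⟨i, y i⟩) := by
    obtain ⟨F, -, hF⟩ := hne
    refine Finset.sum_lt_sum (fun F _ => mul_le_mul_of_nonneg_left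
      (hcon fun i s => F ⟨i, s⟩).le (hw0 F)) ⟨F, Finset.mem_univ _, ?_⟩
    exact mul_lt_mul_of_pos_left (hcon fun i s => F ⟨i, s⟩) ((hw0 F).lt_of_ne' hF)
  rw [← Finset.sum_mul, hw1, one_mul, havg] at this
  exact lt_irrefl _ this

variable {m : ℕ} {𝒳 : Fin m → Type*} [∀ i, Fintype (𝒳 i)] [∀ i, DecidableEq (𝒳 i)]
  {p : (∀ i, 𝒳 i) → ℝ} {n : ℕ} {R : Fin m → ℝ}

/-- The probability that the decoder fails on the source vectors `x` and the messages `a` of the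
traitors. -/
def condError (W : ∀ i, (Fin n → 𝒳 i) → Fin (numMsg n (R i)) → ℝ)
    (g : Msgs n R → ∀ i, Fin n → 𝒳 i) (H : Finset (Fin m)) (x : Fin n → ∀ i, 𝒳 i)
    (a : Msgs n R) : ℝ :=
  ∑ u : Msgs n R, if ∀ i ∈ H, g (received H u a) i = fun k => x k i then 0
    else ∏ i, W i (fun k => x k i) (u i)

lemma errorProb_eq (W : ∀ i, (Fin n → 𝒳 i) → Fin (numMsg n (R i)) → ℝ)
    (g : Msgs n R → ∀ i, Fin n → 𝒳 i) (H : Finset (Fin m))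
    (T : (Fin n → ∀ i, 𝒳 i) → Msgs n R → ℝ) :
    errorProb p W g H T = ∑ x, (∏ k, p (x k)) * ∑ a, T x a * condError W g H x a := by
  unfold errorProb condError
  refine Finset.sum_congr rfl fun x _ => ?_
  rw [Finset.sum_comm, Finset.mul_sum]
  refine Finset.sum_congr rfl fun a _ => ?_
  rw [Finset.mul_sum, Finset.mul_sum]
  refine Finset.sum_congr rfl fun u _ => ?_
  split_ifs <;> ring

lemma errorProb_le (hp : ∀ x, 0 ≤ p x) {W : ∀ i, (Fin n → 𝒳 i) → Fin (numMsg n (R i)) → ℝ}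
    {g : Msgs n R → ∀ i, Fin n → 𝒳 i} {H : Finset (Fin m)}
    {T : (Fin n → ∀ i, 𝒳 i) → Msgs n R → ℝ} (hT : ∀ x, T x ∈ stdSimplex ℝ (Msgs n R))
    {E : (Fin n → ∀ i, 𝒳 i) → ℝ} (h : ∀ x a, condError W g H x a ≤ E x) :
    errorProb p W g H T ≤ ∑ x, (∏ k, p (x k)) * E x := by
  rw [errorProb_eq]
  refine Finset.sum_le_sum fun x _ => mul_le_mul_of_nonneg_left ?_ (prod_block_nonneg hp x)
  calc ∑ a, T x a * condError W g H x a ≤ ∑ a, T x a * E x :=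
        Finset.sum_le_sum fun a _ => mul_le_mul_of_nonneg_left (h x a) ((hT x).1 a)
    _ = E x := by rw [← Finset.sum_mul, (hT x).2, one_mul]

lemma Resists.sum_condError_le {t : ℕ} {ε : ℝ}
    {W : ∀ i, (Fin n → 𝒳 i) → Fin (numMsg n (R i)) → ℝ} {g : Msgs n R → ∀ i, Fin n → 𝒳 i}
    (h : Resists p t ε W g) {H : Finset (Fin m)} (hH : Hᶜ.card ≤ t)
    (a : (Fin n → ∀ i, 𝒳 i) → Msgs n R) :
    ∑ x, (∏ k, p (x k)) * condError W g H x (a x) ≤ ε := by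
  classical
  have := h H hH (fun x => Pi.single (a x) 1) fun x => single_mem_stdSimplex ℝ (a x)
  rw [errorProb_eq] at this
  refine le_trans (Finset.sum_le_sum fun x _ => ?_) this
  rw [Finset.sum_eq_single (a x)]
  · simp
  · intro b _ hb
    simp [Pi.single_eq_of_ne hb]
  · simp

omit [∀ i, Fintype (𝒳 i)] [∀ i, DecidableEq (𝒳 i)] in
lemma prod_single (f : ∀ i, (Fin n → 𝒳 i) → Fin (numMsg n (R i))) (x : Fin n → ∀ i, 𝒳 i)
    (u : Msgs n R) :
    ∏ i, (Pi.single (f i fun k => x k i) 1 : Fin (numMsg n (R i)) → ℝ) (u i) =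
      if u = (fun i => f i fun k => x k i) then 1 else 0 := by
  split_ifs with h
  · subst h
    simp
  · obtain ⟨i, hi⟩ := Function.ne_iff.1 h
    exact Finset.prod_eq_zero (Finset.mem_univ i) (Pi.single_eq_of_ne hi _)

omit [∀ i, Fintype (𝒳 i)] in
lemma condError_single (f : ∀ i, (Fin n → 𝒳 i) → Fin (numMsg n (R i)))
    (g : Msgs n R → ∀ i, Fin n → 𝒳 i) (H : Finset (Fin m)) (x : Fin n → ∀ i, 𝒳 i)
    (a : Msgs n R) :
    condError (fun i s => Pi.single (f i s) 1) g H x a =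
      if ∀ i ∈ H, g (received H (fun i => f i fun k => x k i) a) i = fun k => x k i
        then 0 else 1 := by
  unfold condError
  simp only [prod_single]
  rw [Finset.sum_eq_single (fun i => f i fun k => x k i)]
  · simp
  · intro u _ hu
    simp [hu]
  · simp

lemma exists_deterministic_encoders_le {W : ∀ i, (Fin n → 𝒳 i) → Fin (numMsg n (R i)) → ℝ}
    (hW : ∀ i s, W i s ∈ stdSimplex ℝ (Fin (numMsg n (R i))))
    (g : Msgs n R → ∀ i, Fin n → 𝒳 i) (H : Finset (Fin m)) (a : Msgs n R) :
    ∃ f : ∀ i, (Fin n → 𝒳 i) → Fin (numMsg n (R i)),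
      ∑ x, (∏ k, p (x k)) * condError (fun i s => Pi.single (f i s) 1) g H x a ≤
        ∑ x, (∏ k, p (x k)) * condError W g H x a := by
  classical
  let e : (Fin n → ∀ i, 𝒳 i) ≃ (∀ i, Fin n → 𝒳 i) :=
    ⟨fun x i k => x k i, fun y k i => y i k, fun _ => rfl, fun _ => rfl⟩
  obtain ⟨f, hf⟩ := exists_deterministic_le W hW fun y u =>
    if ∀ i ∈ H, g (received H u a) i = y i then 0 else ∏ k, p (fun i => y i k)
  refine ⟨f, le_trans (le_of_eq ?_) (hf.trans (le_of_eq ?_))⟩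
  · refine Fintype.sum_equiv e _ _ fun x => ?_
    rw [condError_single]
    simp [e]
  · refine (Fintype.sum_equiv e _ _ fun x => ?_).symm
    unfold condError
    rw [Finset.mul_sum]
    refine Finset.sum_congr rfl fun u _ => ?_
    simp only [e, Equiv.coe_fn_mk]
    split_ifs <;> ring

lemma numMsg_le (n : ℕ) (r : ℝ) : (numMsg n r : ℝ) ≤ (2 : ℝ) ^ (n * r) :=
  Nat.floor_le (by positivity)

lemma prod_numMsg_le (n : ℕ) (R : Fin m → ℝ) (A : Finset (Fin m)) :
    ∏ i ∈ A, (numMsg n (R i) : ℝ) ≤ (2 : ℝ) ^ (n * ∑ i ∈ A, R i) := by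
  rw [Finset.mul_sum, Real.rpow_sum_of_pos two_pos]
  exact Finset.prod_le_prod (fun i _ => Nat.cast_nonneg _) fun i _ => numMsg_le n (R i)

/-- If on `G` the messages of the sensors in `s` determine their sequences, then the sensors in `A`
have at least as many messages as there are likely values of `x_A` given `x_{s \ A}`. -/
lemma blockProb_le_of_injOn (hp : ∀ x, 0 ≤ p x) (h1 : ∑ x, p x = 1)
    (f : ∀ i, (Fin n → 𝒳 i) → Fin (numMsg n (R i))) {s A : Finset (Fin m)} (hA : A ⊆ s)
    (G : (Fin n → ∀ i, 𝒳 i) → Prop)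
    (hG : ∀ x y, G x → G y → (∀ i ∈ s, f i (fun k => x k i) = f i fun k => y k i) →
      ∀ k, ∀ i ∈ s, x k i = y k i) {θ : ℝ} (hθ : 0 ≤ θ) :
    blockProb p G ≤ blockProb p (fun x : Fin n → ∀ i, 𝒳 i => ¬ ∏ k, condProb p A (s \ A) (x k) ≤ θ) +
      θ * ∏ i ∈ A, (numMsg n (R i) : ℝ) := by
  classical
  refine le_trans (blockProb_mono hp (F := fun x => ¬ ∏ k, condProb p A (s \ A) (x k) ≤ θ ∨
    (G x ∧ ∏ k, condProb p A (s \ A) (x k) ≤ θ)) fun x hx => by tauto)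
    ((blockProb_or_le hp).trans (add_le_add_right ?_ _))
  -- A fibre of `key` fixes `x_{s \ A}` and the messages on `A`, hence all messages on `s`, so `G`
  -- leaves a single `x_s` in it.
  let key : (Fin n → ∀ i, 𝒳 i) →
      (∀ i : ↥(s \ A), Fin n → 𝒳 i) × (∀ i : A, Fin (numMsg n (R i))) :=
    fun x => (fun i k => x k i, fun i => f i fun k => x k i)
  have hfib : ∀ yv, ∑ x ∈ (Finset.univ.filter fun x => G x ∧ ∏ k, condProb p A (s \ A) (x k) ≤ θ)
      with key x = yv, ∏ k, p (x k) ≤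
      θ * ∑ x : Fin n → ∀ i, 𝒳 i with (fun (i : ↥(s \ A)) k => x k i) = yv.1, ∏ k, p (x k) := by
    intro yv
    rcases Finset.eq_empty_or_nonempty (Finset.filter (fun x => key x = yv)
      (Finset.univ.filter fun x => G x ∧ ∏ k, condProb p A (s \ A) (x k) ≤ θ)) with h | ⟨z, hz⟩
    · rw [h, Finset.sum_empty]
      exact mul_nonneg hθ (Finset.sum_nonneg fun x _ => prod_block_nonneg hp x)
    · simp only [Finset.mem_filter, Finset.mem_univ, true_and] at hz
      obtain ⟨⟨hzG, hzθ⟩, hzk⟩ := hz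
      have e1 : ∑ x ∈ (Finset.univ.filter fun x => G x ∧ ∏ k, condProb p A (s \ A) (x k) ≤ θ)
          with key x = yv, ∏ k, p (x k) ≤ blockProb p fun x => ∀ k, ∀ i ∈ s, x k i = z k i := by
        refine Finset.sum_le_sum_of_subset_of_nonneg (fun x hx => ?_) fun x _ _ =>
          prod_block_nonneg hp x
        simp only [Finset.mem_filter, Finset.mem_univ, true_and] at hx ⊢
        refine hG x z hx.1.1 hzG fun i hi => ?_
        have hk := hx.2.trans hzk.symm
        by_cases hiA : i ∈ A
        · exact congrFun (congrArg Prod.snd hk) ⟨i, hiA⟩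
        · rw [show (fun k => x k i) = fun k => z k i from
            congrFun (congrArg Prod.fst hk) ⟨i, Finset.mem_sdiff.2 ⟨hi, hiA⟩⟩]
      have e2 : ∏ k, marginal p s (z k) =
          (∏ k, condProb p A (s \ A) (z k)) * ∏ k, marginal p (s \ A) (z k) := by
        rw [← Finset.prod_mul_distrib]
        refine Finset.prod_congr rfl fun k _ => ?_
        rw [condProb, Finset.union_sdiff_of_subset hA, div_mul_cancel_of_imp fun h0 => ?_]
        exact le_antisymm ((marginal_anti hp Finset.sdiff_subset _).trans h0.le)
          (marginal_nonneg hp _ _)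
      have e3 : ∏ k, marginal p (s \ A) (z k) =
          ∑ x : Fin n → ∀ i, 𝒳 i with (fun (i : ↥(s \ A)) k => x k i) = yv.1, ∏ k, p (x k) := by
        rw [← blockProb_agree, blockProb]
        refine Finset.sum_congr ?_ fun _ _ => rfl
        ext x
        simp only [Finset.mem_filter, Finset.mem_univ, true_and]
        rw [← hzk]
        simp only [key, funext_iff, Subtype.forall]
        exact ⟨fun h i hi k => h k i hi, fun h k i hi => h i hi k⟩
      rw [← e3]
      refine e1.trans ?_
      rw [blockProb_agree, e2]
      exact mul_le_mul_of_nonneg_right hzθ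
        (Finset.prod_nonneg fun k _ => marginal_nonneg hp _ _)
  calc blockProb p (fun x => G x ∧ ∏ k, condProb p A (s \ A) (x k) ≤ θ)
      = ∑ yv, ∑ x ∈ (Finset.univ.filter fun x => G x ∧ ∏ k, condProb p A (s \ A) (x k) ≤ θ)
          with key x = yv, ∏ k, p (x k) := by
        rw [Finset.sum_fiberwise, blockProb]
        refine Finset.sum_congr ?_ fun _ _ => rfl
        ext; simp
    _ ≤ ∑ yv : (∀ i : ↥(s \ A), Fin n → 𝒳 i) × (∀ i : A, Fin (numMsg n (R i))),
          θ * ∑ x : Fin n → ∀ i, 𝒳 i with (fun (i : ↥(s \ A)) k => x k i) = yv.1, ∏ k, p (x k) :=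
        Finset.sum_le_sum fun yv _ => hfib yv
    _ = θ * ∏ i ∈ A, (numMsg n (R i) : ℝ) := by
        rw [Fintype.sum_prod_type]
        simp only [Finset.sum_const, Finset.card_univ, Fintype.card_pi, Fintype.card_fin,
          ← Finset.smul_sum, ← Finset.mul_sum]
        rw [Finset.sum_fiberwise, sum_prod_block h1, Finset.prod_coe_sort A fun i => numMsg n (R i)]
        rw [nsmul_eq_mul]
        push_cast
        ring

/-- The converse of the Slepian-Wolf theorem, for sets on which the encoders are injective. -/
lemma condEntropy_le_of_injOn (hp : ∀ x, 0 ≤ p x) (h1 : ∑ x, p x = 1) {s A : Finset (Fin m)}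
    (hA : A ⊆ s)
    (h : ∀ᶠ n : ℕ in atTop, ∃ (f : ∀ i, (Fin n → 𝒳 i) → Fin (numMsg n (R i)))
      (G : (Fin n → ∀ i, 𝒳 i) → Prop), 1 / 2 ≤ blockProb p G ∧
      ∀ x y, G x → G y → (∀ i ∈ s, f i (fun k => x k i) = f i fun k => y k i) →
        ∀ k, ∀ i ∈ s, x k i = y k i) :
    condEntropy p A (s \ A) ≤ ∑ i ∈ A, R i := by
  by_contra! hlt
  -- With half the gap as `δ`, the count bounds `1 / 2` by a probability of atypicality plus `2 ^
  -- (-n δ)`, and both tend to zero.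
  set δ := (condEntropy p A (s \ A) - ∑ i ∈ A, R i) / 2 with hδ
  have hδ0 : 0 < δ := by linarith
  have hlim := (tendsto_blockProb_condProb hp h1 A (s \ A) hδ0).add
    (tendsto_pow_atTop_nhds_zero_of_lt_one (r := (2 : ℝ) ^ (-δ)) (by positivity)
      (Real.rpow_lt_one_of_one_lt_of_neg one_lt_two (by linarith)))
  rw [add_zero] at hlim
  obtain ⟨n, ⟨f, G, hG, hinj⟩, hn⟩ :=
    (h.and (hlim.eventually (gt_mem_nhds (show (0 : ℝ) < 1 / 2 by norm_num)))).exists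
  have := blockProb_le_of_injOn hp h1 f hA G hinj
    (θ := (2 : ℝ) ^ (-(n * (condEntropy p A (s \ A) - δ)))) (by positivity)
  have h2 := blockProb_mono hp (E := fun x : Fin n → ∀ i, 𝒳 i => ¬ ∏ k, condProb p A (s \ A) (x k) ≤
      (2 : ℝ) ^ (-(n * (condEntropy p A (s \ A) - δ)))) (F := fun x =>
      ¬ ((2 : ℝ) ^ (-(n * (condEntropy p A (s \ A) + δ))) ≤ ∏ k, condProb p A (s \ A) (x k) ∧
        ∏ k, condProb p A (s \ A) (x k) ≤ (2 : ℝ) ^ (-(n * (condEntropy p A (s \ A) - δ)))))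
    fun x hx hx' => hx hx'.2
  have h3 : (2 : ℝ) ^ (-(n * (condEntropy p A (s \ A) - δ))) * ∏ i ∈ A, (numMsg n (R i) : ℝ) ≤
      ((2 : ℝ) ^ (-δ)) ^ n := by
    refine (mul_le_mul_of_nonneg_left (prod_numMsg_le n R A) (by positivity)).trans ?_
    rw [← Real.rpow_natCast, ← Real.rpow_mul zero_le_two, ← Real.rpow_add two_pos]
    refine Real.rpow_le_rpow_of_exponent_le one_le_two (le_of_eq ?_)
    rw [hδ]; ring
  linarith

end ByzantineSource

/-! ### The two converses and the reduction to rates with slack. -/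

namespace ByzantineSource

variable {m : ℕ} {𝒳 : Fin m → Type*} [∀ i, Fintype (𝒳 i)] [∀ i, DecidableEq (𝒳 i)]
  {p : (∀ i, 𝒳 i) → ℝ} {t : ℕ}

omit [∀ i, DecidableEq (𝒳 i)] in
lemma nonempty_of_sum_eq_one (h1 : ∑ x, p x = 1) : Nonempty (∀ i, 𝒳 i) := by
  by_contra h
  rw [not_nonempty_iff] at h
  simp at h1

/-- The traitors' message is frozen at one `a`, so it is enough to derandomize the encoders for a
single pair `(s, a)`; the resulting encoders need not resist other attacks. -/
lemma randAchievable_subset (hp : ∀ x, 0 ≤ p x) (h1 : ∑ x, p x = 1) (ht : t < m) :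
    randAchievable p t ⊆ rateRegion p (m - t) := by
  classical
  intro R hR s hs A hA _
  refine condEntropy_le_of_injOn hp h1 hA ?_
  filter_upwards [hR (1 / 2) (by norm_num)] with n hn
  obtain ⟨W, g, hW, hres⟩ := hn
  obtain ⟨x₀⟩ := nonempty_of_sum_eq_one h1
  -- With no message available, the law of an encoder would have total mass zero.
  have hne : ∀ i, Nonempty (Fin (numMsg n (R i))) := by
    intro i
    by_contra h
    rw [not_nonempty_iff] at h
    simpa using (hW i fun _ => x₀ i).2
  obtain ⟨a⟩ : Nonempty (Msgs n R) := inferInstance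
  obtain ⟨f, hf⟩ := exists_deterministic_encoders_le (p := p) hW g s a
  refine ⟨f, fun x => ∀ i ∈ s, g (received s (fun i => f i fun k => x k i) a) i = fun k => x k i,
    ?_, ?_⟩
  · have hsc : sᶜ.card ≤ t := by
      rw [Finset.card_compl, Fintype.card_fin, hs]; omega
    have h2 := hf.trans (hres.sum_condError_le hsc fun _ => a)
    have h3 := blockProb_not h1 (n := n) (E := fun x : Fin n → ∀ i, 𝒳 i => ∀ i ∈ s,
      g (received s (fun i => f i fun k => x k i) a) i = fun k => x k i)
    have h4 : blockProb p (fun x : Fin n → ∀ i, 𝒳 i => ¬ ∀ i ∈ s,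
        g (received s (fun i => f i fun k => x k i) a) i = fun k => x k i) =
        ∑ x, (∏ k, p (x k)) * condError (fun i s => Pi.single (f i s) 1) g s x a := by
      rw [blockProb_eq_sum_ite]
      refine Finset.sum_congr rfl fun x _ => ?_
      rw [condError_single]
      split_ifs <;> simp
    linarith
  · intro x y hx hy hxy k i hi
    have : received s (fun i => f i fun k => x k i) a = received s (fun i => f i fun k => y k i) a := by
      funext j
      by_cases hj : j ∈ s
      · simp [received, hj, hxy j hj]
      · simp [received, hj]
    have h2 := hx i hi
    rw [this, hy i hi] at h2
    exact (congrFun h2 k).symm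

/-- The traitors know `x`, hence all honest messages of deterministic encoders, so for each `x` they
can choose an `a` that defeats the decoder whenever one exists. -/
lemma Resists.blockProb_not_le {ε : ℝ} {n : ℕ} {R : Fin m → ℝ}
    {f : ∀ i, (Fin n → 𝒳 i) → Fin (numMsg n (R i))} {g : Msgs n R → ∀ i, Fin n → 𝒳 i}
    (h : Resists p t ε (fun i s => Pi.single (f i s) 1) g) {H : Finset (Fin m)}
    (hH : Hᶜ.card ≤ t) :
    blockProb p (fun x => ¬ ∀ a, ∀ i ∈ H,
      g (received H (fun i => f i fun k => x k i) a) i = fun k => x k i) ≤ ε := by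
  classical
  refine le_trans (le_of_eq ?_) (h.sum_condError_le hH fun x =>
    if hx : ∃ a, ¬ ∀ i ∈ H, g (received H (fun i => f i fun k => x k i) a) i = fun k => x k i
      then hx.choose else fun i => f i fun k => x k i)
  rw [blockProb_eq_sum_ite]
  refine Finset.sum_congr rfl fun x _ => ?_
  rw [condError_single]
  by_cases hx : ∃ a, ¬ ∀ i ∈ H, g (received H (fun i => f i fun k => x k i) a) i = fun k => x k i
  · rw [if_pos (not_forall.2 hx), dif_pos hx, if_neg hx.choose_spec, mul_one]
  · rw [if_neg (fun h => hx (not_forall.1 h)), if_pos (not_not.1 (not_exists.1 hx _)), mul_zero]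

lemma detAchievable_subset (hp : ∀ x, 0 ≤ p x) (h1 : ∑ x, p x = 1) :
    detAchievable p t ⊆ rateRegion p (max 1 (m - 2 * t)) := by
  classical
  intro R hR s hs A hA _
  refine condEntropy_le_of_injOn hp h1 hA ?_
  have hsc : sᶜ.card ≤ 2 * t := by
    rw [Finset.card_compl, Fintype.card_fin, hs]; omega
  -- `T` and `sᶜ \ T` are two possible sets of traitors, each of size at most `t`.
  obtain ⟨T, hTs, hT⟩ := Finset.exists_subset_card_eq (min_le_right t sᶜ.card)
  have hT' : (sᶜ \ T).card ≤ t := by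
    rw [Finset.card_sdiff_of_subset hTs, hT]; omega
  filter_upwards [hR (1 / 4) (by norm_num)] with n hn
  obtain ⟨f, g, hres⟩ := hn
  refine ⟨f, fun x =>
    (∀ a, ∀ i ∈ Tᶜ, g (received Tᶜ (fun i => f i fun k => x k i) a) i = fun k => x k i) ∧
    ∀ a, ∀ i ∈ (sᶜ \ T)ᶜ, g (received (sᶜ \ T)ᶜ (fun i => f i fun k => x k i) a) i =
      fun k => x k i, ?_, ?_⟩
  · have e1 := hres.blockProb_not_le (H := Tᶜ) (by rw [compl_compl, hT]; exact min_le_left _ _)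
    have e2 := hres.blockProb_not_le (H := (sᶜ \ T)ᶜ) (by rwa [compl_compl])
    have e3 := blockProb_not h1 (n := n) (E := fun x : Fin n → ∀ i, 𝒳 i =>
      (∀ a, ∀ i ∈ Tᶜ, g (received Tᶜ (fun i => f i fun k => x k i) a) i = fun k => x k i) ∧
      ∀ a, ∀ i ∈ (sᶜ \ T)ᶜ, g (received (sᶜ \ T)ᶜ (fun i => f i fun k => x k i) a) i =
        fun k => x k i)
    have e4 := blockProb_or_le hp (n := n) (E := fun x : Fin n → ∀ i, 𝒳 i => ¬ ∀ a, ∀ i ∈ Tᶜ,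
      g (received Tᶜ (fun i => f i fun k => x k i) a) i = fun k => x k i)
      (F := fun x : Fin n → ∀ i, 𝒳 i => ¬ ∀ a, ∀ i ∈ (sᶜ \ T)ᶜ,
        g (received (sᶜ \ T)ᶜ (fun i => f i fun k => x k i) a) i = fun k => x k i)
    simp only [not_and_or] at e3
    linarith
  · rintro x y ⟨hx, -⟩ ⟨-, hy⟩ hxy k i hi
    -- Source `x` with `T` imitating `y` looks to the decoder like source `y` with `sᶜ \ T`
    -- imitating `x`.
    have hrec : received Tᶜ (fun i => f i fun k => x k i) (fun i => f i fun k => y k i) =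
        received (sᶜ \ T)ᶜ (fun i => f i fun k => y k i) (fun i => f i fun k => x k i) := by
      funext j
      by_cases hjs : j ∈ s
      · simp [received, hjs, hxy j hjs]
      · by_cases hjT : j ∈ T <;> simp [received, hjs, hjT]
    have hiT : i ∉ T := fun h => Finset.mem_compl.1 (hTs h) hi
    have h2 := hx (fun i => f i fun k => y k i) i (Finset.mem_compl.2 hiT)
    rw [hrec, hy _ i (by simp [hi])] at h2
    exact (congrFun h2 k).symm

lemma isClosed_rateRegion (p : (∀ i, 𝒳 i) → ℝ) (k : ℕ) : IsClosed (rateRegion p k) := by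
  simp only [rateRegion, slepianWolf, Set.ofPred_forall]
  refine isClosed_iInter fun s => isClosed_iInter fun _ => isClosed_iInter fun A =>
    isClosed_iInter fun _ => isClosed_iInter fun _ => isClosed_le continuous_const ?_
  fun_prop

/-- The rate vectors that meet the constraints of `rateRegion p k` with margin `δ`. -/
def Slack (p : (∀ i, 𝒳 i) → ℝ) (k : ℕ) (δ : ℝ) (R : Fin m → ℝ) : Prop :=
  (∀ i, 0 < R i) ∧ ∀ s : Finset (Fin m), s.card = k → ∀ A ⊆ s, A.Nonempty →
    condEntropy p A (s \ A) + δ ≤ ∑ i ∈ A, R i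

/-- Adding `δ` to every rate gains at least `δ` in each sum over a nonempty set. The bounds on `k`
put each sensor into some set of size `k`, which makes its rate nonnegative. -/
lemma closure_eq_rateRegion (hp : ∀ x, 0 ≤ p x) {k : ℕ} (hk1 : 1 ≤ k) (hkm : k ≤ m)
    {𝒜 : Set (Fin m → ℝ)} (hsub : 𝒜 ⊆ rateRegion p k)
    (hslack : ∀ δ > 0, ∀ R, Slack p k δ R → R ∈ 𝒜) : closure 𝒜 = rateRegion p k := by
  refine (closure_minimal hsub (isClosed_rateRegion p k)).antisymm fun R hR => ?_
  have hR0 : ∀ i, 0 ≤ R i := by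
    intro i
    obtain ⟨s, his, hs⟩ := Finset.exists_superset_card_eq (s := {i}) (n := k) (by simpa) (by simpa)
    have := hR s hs {i} his (Finset.singleton_nonempty i)
    rw [Finset.sum_singleton] at this
    exact (condEntropy_nonneg hp _ _).trans this
  have hlim : Tendsto (fun δ : ℝ => fun i => R i + δ) (𝓝[>] 0) (𝓝 R) := by
    have : Tendsto (fun δ : ℝ => fun i => R i + δ) (𝓝 0) (𝓝 fun i => R i + 0) :=
      (by fun_prop : Continuous fun δ : ℝ => fun i => R i + δ).tendsto 0
    simp only [add_zero] at this
    exact this.mono_left nhdsWithin_le_nhds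
  refine mem_closure_of_tendsto hlim ?_
  filter_upwards [self_mem_nhdsWithin] with δ hδ
  have hδ' : (0 : ℝ) < δ := hδ
  refine hslack δ hδ' _ ⟨fun i => by linarith [hR0 i], fun s hs A hA hne => ?_⟩
  have h1 := hR s hs A hA hne
  have h2 : (1 : ℝ) ≤ A.card := by exact_mod_cast hne.card_pos
  rw [Finset.sum_add_distrib, Finset.sum_const, nsmul_eq_mul]
  nlinarith

end ByzantineSource

/-! ### Typical sets, the decoder and deterministic coding. -/

namespace ByzantineSource

variable {m : ℕ} {𝒳 : Fin m → Type*} [∀ i, Fintype (𝒳 i)] [∀ i, DecidableEq (𝒳 i)]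
  {p : (∀ i, 𝒳 i) → ℝ} {t n : ℕ}

open Classical in
/-- The tuples of sequences, one for each sensor, that are typical on `S`. -/
def typSet (p : (∀ i, 𝒳 i) → ℝ) (δ : ℝ) (S : Finset (Fin m)) (n : ℕ) :
    Finset (∀ i, Fin n → 𝒳 i) :=
  Finset.univ.filter fun y => Typ p δ S fun k i => y i k

lemma mem_typSet {δ : ℝ} {S : Finset (Fin m)} {y : ∀ i, Fin n → 𝒳 i} :
    y ∈ typSet p δ S n ↔ Typ p δ S fun k i => y i k := by
  simp [typSet]

/-- Typicality uses up half of the margin `δ`, and the other half is the exponential gain. The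
factor `c` absorbs the rounding of the message counts and the share of them spent on seeds. -/
lemma card_le_of_subset_typSet (hp : ∀ x, 0 ≤ p x) {k : ℕ} {δ : ℝ} {R : Fin m → ℝ}
    (hR : Slack p k δ R) {S : Finset (Fin m)} (hS : S.card = k) {c : ℝ} (hc : 1 ≤ c)
    {N : Fin m → ℕ} (hN : ∀ i, (2 : ℝ) ^ (n * R i) ≤ c * N i) {D : Finset (Fin m)} (hD : D ⊆ S)
    (hne : D.Nonempty) (z : ∀ i, Fin n → 𝒳 i) (B : Finset (∀ i, Fin n → 𝒳 i))
    (hB : ∀ y ∈ B, y ∈ typSet p (δ / 2) S n ∧ ∀ i ∉ D, y i = z i) :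
    (B.card : ℝ) ≤
      c ^ m * (2 : ℝ) ^ (-(n * (δ / 2))) * ∏ i ∈ D, (N i : ℝ) := by
  have h1 := card_typ_le (p := p) hp hD (δ := δ / 2) (fun k i => z i k)
    (B.image fun y k i => y i k)
    (by
      intro x hx
      obtain ⟨y, hy, rfl⟩ := Finset.mem_image.1 hx
      exact ⟨fun k i hi => congrFun ((hB y hy).2 i hi) k, mem_typSet.1 (hB y hy).1⟩)
  rw [Finset.card_image_of_injective _ fun y y' h => by
    funext i k
    exact congrFun (congrFun h k) i] at h1
  refine h1.trans ?_
  have h2 := hR.2 S hS D hD hne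
  calc (2 : ℝ) ^ (n * (condEntropy p D (S \ D) + δ / 2))
      ≤ (2 : ℝ) ^ (-(n * (δ / 2)) + ∑ i ∈ D, n * R i) := by
        refine Real.rpow_le_rpow_of_exponent_le one_le_two ?_
        rw [← Finset.mul_sum]
        have := mul_le_mul_of_nonneg_left h2 (Nat.cast_nonneg (α := ℝ) n)
        linarith
    _ = (2 : ℝ) ^ (-(n * (δ / 2))) * ∏ i ∈ D, (2 : ℝ) ^ (n * R i) := by
        rw [Real.rpow_add two_pos, Real.rpow_sum_of_pos two_pos]
    _ ≤ (2 : ℝ) ^ (-(n * (δ / 2))) * ∏ i ∈ D, (c * N i) := by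
        gcongr with i hi
        exact hN i
    _ = c ^ D.card * (2 : ℝ) ^ (-(n * (δ / 2))) * ∏ i ∈ D, (N i : ℝ) := by
        rw [Finset.prod_mul_distrib, Finset.prod_const]; ring
    _ ≤ _ := by
        have hDm : D.card ≤ m := by simpa using Finset.card_le_univ D
        gcongr

open Classical in
lemma card_forall_exists_typical_rival_le {κ : Type*} [Fintype κ] [DecidableEq κ]
    (hp : ∀ x, 0 ≤ p x) {k : ℕ} {δ : ℝ} {R : Fin m → ℝ}
    (hR : Slack p k δ R) {S : Finset (Fin m)} (hS : S.card = k) {c : ℝ} (hc : 1 ≤ c)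
    {N : Fin m → ℕ} (hN0 : ∀ i, 0 < N i) (hN : ∀ i, (2 : ℝ) ^ (n * R i) ≤ c * N i)
    {A U : Finset (Fin m)} (hAU : Disjoint A U) (hA : A.Nonempty) (hS' : A ∪ U ⊆ S)
    (x : ∀ i, Fin n → 𝒳 i) (b : ∀ i, Fin (N i)) {r : ℕ} (σ : Fin r → Fin m → κ)
    (hσ : ∀ i ∈ A, Function.Injective fun j => σ j i) :
    ((Finset.univ.filter fun F : Codebook κ (fun i => Fin n → 𝒳 i) N =>
        ∀ j, ∃ y, Rival (typSet p (δ / 2) S n) A U x y ∧ Collides F A U x b (σ j) y).card : ℝ) ≤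
      ((r : ℝ) ^ m * (c ^ m * (2 : ℝ) ^ (-(n * (δ / 2))))) ^ r *
        Fintype.card (Codebook κ (fun i => Fin n → 𝒳 i) N) := by
  have hq : 0 ≤ c ^ m * (2 : ℝ) ^ (-(n * (δ / 2))) := by positivity
  have := card_forall_exists_rival_le (x := x) (b := b) hq hN0 hAU
    (fun D hAD hDU => card_le_of_subset_typSet hp hR hS hc hN (hDU.trans hS') (hA.mono hAD)) σ hσ
  rw [Fintype.card_fin] at this
  exact this

section Decoder

variable {κ : Type*} {N : Fin m → ℕ}

/-- `y` is typical on a set `S` of `l` sensors that contains `i`, and on `S` it agrees with the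
received seeds and bins. -/
def Candidate (p : (∀ i, 𝒳 i) → ℝ) (δ : ℝ) (l : ℕ) (F : Codebook κ (fun i => Fin n → 𝒳 i) N)
    (cb : ∀ i, κ × Fin (N i)) (i : Fin m) (S : Finset (Fin m)) (y : ∀ i, Fin n → 𝒳 i) : Prop :=
  i ∈ S ∧ S.card = l ∧ y ∈ typSet p δ S n ∧ ∀ j ∈ S, F ⟨j, (cb j).1, y j⟩ = (cb j).2

open Classical in
/-- The decoder takes its estimate of sequence `i` from any candidate; `d` is a default value. -/
def decode (p : (∀ i, 𝒳 i) → ℝ) (δ : ℝ) (l : ℕ) (d : ∀ i, Fin n → 𝒳 i)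
    (F : Codebook κ (fun i => Fin n → 𝒳 i) N) (cb : ∀ i, κ × Fin (N i)) (i : Fin m) :
    Fin n → 𝒳 i :=
  if h : ∃ Sy : Finset (Fin m) × (∀ i, Fin n → 𝒳 i), Candidate p δ l F cb i Sy.1 Sy.2
    then h.choose.2 i else d i

/-- There are at least `m - t` honest sensors, so `i` lies in a set of `m - t` of them, on which `x`
itself is a candidate. The default value is thus never used, and a wrong estimate comes from a wrong
candidate. -/
lemma exists_candidate_of_decode_ne {δ : ℝ} {d x : ∀ i, Fin n → 𝒳 i}
    {F : Codebook κ (fun i => Fin n → 𝒳 i) N} {cb : ∀ i, κ × Fin (N i)} {H : Finset (Fin m)}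
    (ht : t < m) (hH : Hᶜ.card ≤ t) (hx : x ∈ typSet p δ Finset.univ n)
    (hcb : ∀ j ∈ H, F ⟨j, (cb j).1, x j⟩ = (cb j).2) {i : Fin m} (hi : i ∈ H)
    (hne : decode p δ (m - t) d F cb i ≠ x i) :
    ∃ S y, Candidate p δ (m - t) F cb i S y ∧ y i ≠ x i := by
  have hHc : m - t ≤ H.card := by
    rw [Finset.card_compl, Fintype.card_fin] at hH; omega
  obtain ⟨S, hiS, hSH, hS⟩ := Finset.exists_subsuperset_card_eq (s := {i}) (t := H) (n := m - t)
    (by simpa) (by simp; omega) hHc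
  have h : ∃ Sy : Finset (Fin m) × (∀ i, Fin n → 𝒳 i),
      Candidate p δ (m - t) F cb i Sy.1 Sy.2 :=
    ⟨(S, x), hiS (by simp), hS, mem_typSet.2 ((mem_typSet.1 hx).mono (Finset.subset_univ S)),
      fun j hj => hcb j (hSH hj)⟩
  refine ⟨h.choose.1, h.choose.2, h.choose_spec, ?_⟩
  rwa [decode, dif_pos h] at hne

/-- `A` collects the honest places of `s` where `y` is wrong, and `y` is replaced by `x` outside
`s`. Deterministic coding uses `s ⊆ S ∩ H`, where `s \ H` is empty; randomized coding uses `s = S`.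
-/
lemma Candidate.exists_rival {δ : ℝ} {l : ℕ} {x y : ∀ i, Fin n → 𝒳 i}
    {F : Codebook κ (fun i => Fin n → 𝒳 i) N} {cb : ∀ i, κ × Fin (N i)} {H S s : Finset (Fin m)}
    {i : Fin m} (hy : Candidate p δ l F cb i S y)
    (hcb : ∀ j ∈ H, F ⟨j, (cb j).1, x j⟩ = (cb j).2) (hs : s ⊆ S) (his : i ∈ s) (hiH : i ∈ H)
    (hne : y i ≠ x i) :
    ∃ A, A.Nonempty ∧ A ⊆ s ∧ A ⊆ H ∧ ∃ y', Rival (typSet p δ s n) A (s \ H) x y' ∧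
      Collides F A (s \ H) x (fun j => (cb j).2) (fun j => (cb j).1) y' := by
  classical
  obtain ⟨-, -, hyT, hyF⟩ := hy
  refine ⟨(s ∩ H).filter fun j => y j ≠ x j, ⟨i, by simp [his, hiH, hne]⟩,
    (Finset.filter_subset _ _).trans Finset.inter_subset_left,
    (Finset.filter_subset _ _).trans Finset.inter_subset_right,
    fun j => if j ∈ s then y j else x j, ⟨?_, ?_, ?_⟩, ?_, ?_⟩
  · refine mem_typSet.2 (((mem_typSet.1 hyT).mono hs).congr fun k j hj => ?_)
    simp [hj]
  · intro j hj
    by_cases hjs : j ∈ s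
    · simp only [Finset.mem_union, Finset.mem_filter, Finset.mem_inter, Finset.mem_sdiff, hjs,
        true_and, not_or, not_not, not_and] at hj
      simp [hjs, hj.1 hj.2]
    · simp [hjs]
  · intro j hj
    simp only [Finset.mem_filter, Finset.mem_inter] at hj
    simpa [hj.1.1] using hj.2
  · intro j hj
    simp only [Finset.mem_filter, Finset.mem_inter] at hj
    dsimp only
    rw [if_pos hj.1.1, hyF j (hs hj.1.1), hcb j hj.1.2]
  · intro j hj
    rw [Finset.mem_sdiff] at hj
    dsimp only
    rw [if_pos hj.1]
    exact hyF j (hs hj.1)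

end Decoder

lemma rpow_le_two_mul_numMsg {r : ℝ} (hr : 0 ≤ r) : (2 : ℝ) ^ (n * r) ≤ 2 * numMsg n r := by
  have h1 : (1 : ℝ) ≤ (2 : ℝ) ^ (n * r) := Real.one_le_rpow one_le_two (by positivity)
  have h2 : 1 ≤ numMsg n r := Nat.le_floor (by exact_mod_cast h1)
  have h3 : (2 : ℝ) ^ (n * r) < numMsg n r + 1 := Nat.lt_floor_add_one _
  have h4 : (1 : ℝ) ≤ numMsg n r := by exact_mod_cast h2
  linarith

lemma numMsg_pos {r : ℝ} (hr : 0 ≤ r) : 0 < numMsg n r :=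
  Nat.floor_pos.2 (Real.one_le_rpow one_le_two (by positivity))

open Classical in
/-- Some deterministic codebook confuses typical tuples on sets of `k` sensors only with small
probability. -/
lemma exists_codebook (hp : ∀ x, 0 ≤ p x) (h1 : ∑ x, p x = 1) {k : ℕ} {δ : ℝ} {R : Fin m → ℝ}
    (hR : Slack p k δ R) (n : ℕ) :
    ∃ F : Codebook Unit (fun i => Fin n → 𝒳 i) (fun i => numMsg n (R i)),
      blockProb p (fun x : Fin n → ∀ i, 𝒳 i => ∃ s : Finset (Fin m), s.card = k ∧ ∃ A ⊆ s,
        A.Nonempty ∧ ∃ y b, Rival (typSet p (δ / 2) s n) A ∅ (fun i k => x k i) y ∧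
          Collides F A ∅ (fun i k => x k i) b (fun _ => ()) y) ≤
        4 ^ m * (2 ^ m * (2 : ℝ) ^ (-(n * (δ / 2)))) := by
  have hN0 : ∀ i, 0 < numMsg n (R i) := fun i => numMsg_pos (hR.1 i).le
  -- Here `U = ∅`, so the prescribed bins do not matter.
  let b₀ : ∀ i, Fin (numMsg n (R i)) := fun i => ⟨0, hN0 i⟩
  let Φ := Codebook Unit (fun i => Fin n → 𝒳 i) (fun i => numMsg n (R i))
  have hne : Nonempty Φ := ⟨fun k => b₀ k.1⟩
  set q : ℝ := 2 ^ m * (2 : ℝ) ^ (-(n * (δ / 2))) with hq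
  have hq0 : 0 ≤ q := by positivity
  by_contra! hcon
  let bad : Φ → (Finset (Fin m) × Finset (Fin m)) → (Fin n → ∀ i, 𝒳 i) → Prop := fun F sA x =>
    sA.1.card = k ∧ sA.2 ⊆ sA.1 ∧ sA.2.Nonempty ∧
      ∃ y, Rival (typSet p (δ / 2) sA.1 n) sA.2 ∅ (fun i k => x k i) y ∧
        Collides F sA.2 ∅ (fun i k => x k i) b₀ (fun _ => ()) y
  -- First-moment argument over all codebooks; `4 ^ m` is the number of pairs `(s, A)`.
  have hlow : ∀ F : Φ, 4 ^ m * q < ∑ sA, blockProb p (bad F sA) := by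
    intro F
    refine (hcon F).trans_le (le_trans (blockProb_mono hp fun x hx => ?_)
      (blockProb_exists_le _ _ hp))
    obtain ⟨s, hs, A, hA, hAne, y, b, hy, hc⟩ := hx
    exact ⟨(s, A), Finset.mem_univ _, hs, hA, hAne, y, hy, hc.1, by simp⟩
  have hup : ∀ sA, ∑ F : Φ, blockProb p (bad F sA) ≤ q * Fintype.card Φ := by
    intro sA
    simp only [blockProb_eq_sum_ite]
    rw [Finset.sum_comm]
    have : ∀ x : Fin n → ∀ i, 𝒳 i, ∑ F : Φ, (if bad F sA x then ∏ k, p (x k) else 0) ≤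
        (∏ k, p (x k)) * (q * Fintype.card Φ) := by
      intro x
      rw [← Finset.sum_filter, Finset.sum_const, nsmul_eq_mul, mul_comm]
      refine mul_le_mul_of_nonneg_left ?_ (prod_block_nonneg hp x)
      by_cases h : sA.1.card = k ∧ sA.2 ⊆ sA.1 ∧ sA.2.Nonempty
      · have := card_forall_exists_typical_rival_le hp hR h.1 one_le_two hN0
          (fun i => rpow_le_two_mul_numMsg (hR.1 i).le) (Finset.disjoint_empty_right sA.2) h.2.2
          (by simpa using h.2.1) (fun i k => x k i) b₀ (r := 1) (fun _ _ => ())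
          (fun i _ => Function.injective_of_subsingleton _)
        rw [Nat.cast_one, one_pow, one_mul, pow_one, ← hq] at this
        refine le_trans (Nat.cast_le.2 (Finset.card_le_card fun F hF => ?_)) this
        simp only [Finset.mem_filter, Finset.mem_univ, true_and] at hF ⊢
        exact fun _ => hF.2.2.2
      · rw [Finset.filter_false_of_mem fun F _ hF => h ⟨hF.1, hF.2.1, hF.2.2.1⟩]
        simp only [Finset.card_empty, Nat.cast_zero]
        positivity
    refine (Finset.sum_le_sum fun x _ => this x).trans ?_
    rw [← Finset.sum_mul, sum_prod_block h1, one_mul]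
  have h2 : ∑ F : Φ, 4 ^ m * q < ∑ F : Φ, ∑ sA, blockProb p (bad F sA) :=
    Finset.sum_lt_sum_of_nonempty Finset.univ_nonempty fun F _ => hlow F
  rw [Finset.sum_comm] at h2
  have h3 := h2.trans_le (Finset.sum_le_sum fun sA _ => hup sA)
  simp only [Finset.sum_const, Finset.card_univ, Fintype.card_prod, Fintype.card_finset,
    Fintype.card_fin, nsmul_eq_mul] at h3
  refine absurd h3 (not_lt.2 (le_of_eq ?_))
  push_cast
  rw [← mul_pow]
  norm_num
  ring

lemma tendsto_two_rpow_neg {δ : ℝ} (hδ : 0 < δ) :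
    Tendsto (fun n : ℕ => (2 : ℝ) ^ (-(n * δ))) atTop (𝓝 0) := by
  have := tendsto_pow_atTop_nhds_zero_of_lt_one (r := (2 : ℝ) ^ (-δ)) (by positivity)
      (Real.rpow_lt_one_of_one_lt_of_neg one_lt_two (by linarith))
  refine this.congr fun n => ?_
  rw [← Real.rpow_natCast, ← Real.rpow_mul zero_le_two]
  congr 1
  ring

lemma mem_detAchievable_of_slack (hp : ∀ x, 0 ≤ p x) (h1 : ∑ x, p x = 1) (ht : t < m) {δ : ℝ}
    (hδ : 0 < δ) {R : Fin m → ℝ} (hR : Slack p (max 1 (m - 2 * t)) δ R) :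
    R ∈ detAchievable p t := by
  classical
  intro ε hε
  have hlim := (tendsto_blockProb_not_typ hp h1 (half_pos hδ)).add
    (((tendsto_two_rpow_neg (half_pos hδ)).const_mul (2 ^ m)).const_mul (4 ^ m))
  rw [mul_zero, mul_zero, add_zero] at hlim
  filter_upwards [hlim.eventually (gt_mem_nhds hε)] with n hn
  obtain ⟨x₀⟩ := nonempty_of_sum_eq_one h1
  obtain ⟨F, hF⟩ := exists_codebook hp h1 hR n
  refine ⟨fun i y => F ⟨i, (), y⟩,
    fun I => decode p (δ / 2) (m - t) (fun i _ => x₀ i) F fun i => ((), I i), ?_⟩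
  intro H hH T hT
  refine (errorProb_le hp hT (E := fun x => if ¬ Typ p (δ / 2) Finset.univ x ∨
      ∃ s : Finset (Fin m), s.card = max 1 (m - 2 * t) ∧ ∃ A ⊆ s,
        A.Nonempty ∧ ∃ y b, Rival (typSet p (δ / 2) s n) A ∅ (fun i k => x k i) y ∧
          Collides F A ∅ (fun i k => x k i) b (fun _ => ()) y then 1 else 0) ?_).trans ?_
  · intro x a
    rw [condError_single]
    split_ifs with hok hbad hbad
    · exact zero_le_one
    · exact le_rfl
    · exact le_rfl
    · exfalso
      push Not at hok
      obtain ⟨i, hi, hne⟩ := hok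
      refine hbad (or_iff_not_imp_left.2 fun htyp => ?_)
      rw [not_not] at htyp
      have hcb : ∀ j ∈ H, F ⟨j, (), fun k => x k j⟩ =
          received H (fun i => F ⟨i, (), fun k => x k i⟩) a j := fun j hj => by simp [received, hj]
      obtain ⟨S, y, hy, hyx⟩ := exists_candidate_of_decode_ne (x := fun i k => x k i) ht hH
        (mem_typSet.2 htyp) hcb hi hne
      -- `S` and `H` each miss at most `t` sensors. The `1` in the maximum is covered by `i ∈ S ∩
      -- H`.
      have hcard : m - 2 * t ≤ (S ∩ H).card := by
        have h1 := Finset.card_union_add_card_inter S H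
        have h2 := Finset.card_le_univ (S ∪ H)
        have h3 := hy.2.1
        rw [Finset.card_compl] at hH
        rw [Fintype.card_fin] at hH h2
        omega
      have hpos : 1 ≤ (S ∩ H).card := Finset.card_pos.2 ⟨i, Finset.mem_inter.2 ⟨hy.1, hi⟩⟩
      obtain ⟨s, his, hsSH, hs⟩ := Finset.exists_subsuperset_card_eq (s := {i}) (t := S ∩ H)
        (n := max 1 (m - 2 * t)) (by simpa using ⟨hy.1, hi⟩) (by simp) (max_le hpos hcard)
      have hsH : s ⊆ H := hsSH.trans Finset.inter_subset_right
      obtain ⟨A, hA, hAs, -, y', hy', hc'⟩ := hy.exists_rival hcb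
        (hsSH.trans Finset.inter_subset_left) (his (by simp)) hi hyx
      rw [Finset.sdiff_eq_empty_iff_subset.2 hsH] at hy' hc'
      exact ⟨s, hs, A, hAs, hA, y', _, hy', hc'⟩
  · simp only [mul_ite, mul_one, mul_zero]
    rw [← blockProb_eq_sum_ite]
    exact (blockProb_or_le hp).trans ((add_le_add_right hF _).trans hn.le)

end ByzantineSource

/-! ### Robust codebooks and random seeds. -/

namespace ByzantineSource

open Classical in
/-- If every diagonal contains at most `r` points of `B`, then `B` has at most the fraction
`r / card κ` of all points. -/
lemma card_mul_card_le_of_diagonal {ι κ : Type*} [Fintype ι] [DecidableEq ι] [Fintype κ] [AddGroup κ]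
    (B : Finset (ι → κ)) (r : ℕ)
    (h : ∀ o : ι → κ, (Finset.univ.filter fun j : κ => (fun i => o i + j) ∈ B).card ≤ r) :
    Fintype.card κ * B.card ≤ r * Fintype.card (ι → κ) := by
  -- Translation by a constant vector permutes `ι → κ`, so each shift sees all of `B`.
  have h1 : ∀ j : κ, B.card = ∑ o : ι → κ, if (fun i => o i + j) ∈ B then 1 else 0 := by
    intro j
    have := Fintype.sum_equiv (Equiv.addRight (fun _ : ι => j))
      (fun o => if (fun i => o i + j) ∈ B then 1 else 0) (fun o => if o ∈ B then 1 else 0)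
      fun o => rfl
    rw [this]
    simp
  calc Fintype.card κ * B.card
      = ∑ j : κ, ∑ o : ι → κ, if (fun i => o i + j) ∈ B then 1 else 0 := by
        rw [← Finset.sum_congr rfl fun j _ => h1 j]; simp
    _ = ∑ o : ι → κ, (Finset.univ.filter fun j : κ => (fun i => o i + j) ∈ B).card := by
        rw [Finset.sum_comm]; simp
    _ ≤ ∑ _o : ι → κ, r := Finset.sum_le_sum fun o _ => h o
    _ = _ := by simp [mul_comm]

variable {m : ℕ} {𝒳 : Fin m → Type*} [∀ i, Fintype (𝒳 i)] [∀ i, DecidableEq (𝒳 i)]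
  {p : (∀ i, 𝒳 i) → ℝ} {t n : ℕ}

/-- No choice of `r` shifted seeds lets rivals of `x` collide with `x` for each of them. -/
def Robust {κ : Type*} [Add κ] {N : Fin m → ℕ} (p : (∀ i, 𝒳 i) → ℝ) (δ : ℝ) (k r : ℕ)
    (F : Codebook κ (fun i => Fin n → 𝒳 i) N) : Prop :=
  ∀ (S A U : Finset (Fin m)), S.card = k → Disjoint A U → A.Nonempty → A ∪ U ⊆ S →
    ∀ (x : ∀ i, Fin n → 𝒳 i) (b : ∀ i, Fin (N i)) (w : Fin m → κ) (τ : Fin r → κ),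
      Function.Injective τ → ∃ j, ∀ y, Rival (typSet p δ S n) A U x y →
        ¬ Collides F A U x b (fun i => if i ∈ U then w i else w i + τ j) y

-- Union bound over sets, sources, bins and seeds. Only the `r`-th power in `hsmall` makes the bound
-- for one choice small enough against the exponentially many choices.
open Classical in
lemma exists_robust {κ : Type*} [Fintype κ] [AddGroup κ] [DecidableEq κ] (hp : ∀ x, 0 ≤ p x)
    {k : ℕ} {δ : ℝ} {R : Fin m → ℝ} (hR : Slack p k δ R) {c : ℝ} (hc : 1 ≤ c) {N : Fin m → ℕ}
    (hN0 : ∀ i, 0 < N i) (hN : ∀ i, (2 : ℝ) ^ (n * R i) ≤ c * N i) (r : ℕ)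
    (hsmall : (Fintype.card ((Finset (Fin m) × Finset (Fin m) × Finset (Fin m)) ×
      (∀ i, Fin n → 𝒳 i) × (∀ i, Fin (N i)) × (Fin m → κ) × (Fin r → κ)) : ℝ) *
        ((r : ℝ) ^ m * (c ^ m * (2 : ℝ) ^ (-(n * (δ / 2))))) ^ r < 1) :
    ∃ F : Codebook κ (fun i => Fin n → 𝒳 i) N, Robust p (δ / 2) k r F := by
  by_contra hcon
  push Not at hcon
  let Φ := Codebook κ (fun i => Fin n → 𝒳 i) N
  have hne : Nonempty Φ := ⟨fun k => ⟨0, hN0 k.1⟩⟩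
  have hpos : (0 : ℝ) < Fintype.card Φ := by exact_mod_cast Fintype.card_pos
  let bad : ((Finset (Fin m) × Finset (Fin m) × Finset (Fin m)) ×
      (∀ i, Fin n → 𝒳 i) × (∀ i, Fin (N i)) × (Fin m → κ) × (Fin r → κ)) → Finset Φ :=
    fun ⟨⟨S, A, U⟩, x, b, w, τ⟩ => Finset.univ.filter fun F =>
      (S.card = k ∧ Disjoint A U ∧ A.Nonempty ∧ A ∪ U ⊆ S ∧ Function.Injective τ) ∧
      ∀ j, ∃ y, Rival (typSet p (δ / 2) S n) A U x y ∧
        Collides F A U x b (fun i => if i ∈ U then w i else w i + τ j) y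
  set Q := ((r : ℝ) ^ m * (c ^ m * (2 : ℝ) ^ (-(n * (δ / 2))))) ^ r with hQ
  have hQ0 : 0 ≤ Q := by positivity
  have hbad : ∀ P, ((bad P).card : ℝ) ≤ Q * Fintype.card Φ := by
    rintro ⟨⟨S, A, U⟩, x, b, w, τ⟩
    by_cases h : S.card = k ∧ Disjoint A U ∧ A.Nonempty ∧ A ∪ U ⊆ S ∧ Function.Injective τ
    · obtain ⟨hS, hAU, hA, hAS, hτ⟩ := h
      refine le_trans (Nat.cast_le.2 (Finset.card_le_card fun F hF => ?_))
        (card_forall_exists_typical_rival_le hp hR hS hc hN0 hN hAU hA hAS x b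
        (fun j i => if i ∈ U then w i else w i + τ j) fun i hi j j' hjj => ?_)
      · simp only [bad, Finset.mem_filter, Finset.mem_univ, true_and] at hF ⊢
        exact hF.2
      · have hiU : i ∉ U := Finset.disjoint_left.1 hAU hi
        simp only [hiU, if_false] at hjj
        exact hτ (add_left_cancel hjj)
    · have : bad ⟨⟨S, A, U⟩, x, b, w, τ⟩ = ∅ :=
        Finset.filter_false_of_mem fun F _ hF => h hF.1
      rw [this, Finset.card_empty, Nat.cast_zero]
      positivity
  have hcover : (Finset.univ : Finset Φ) ⊆ Finset.univ.biUnion bad := by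
    intro F _
    have hF := hcon F
    unfold Robust at hF
    push Not at hF
    obtain ⟨S, A, U, hS, hAU, hA, hAS, x, b, w, τ, hτ, h⟩ := hF
    refine Finset.mem_biUnion.2 ⟨⟨⟨S, A, U⟩, x, b, w, τ⟩, Finset.mem_univ _, ?_⟩
    exact Finset.mem_filter.2 ⟨Finset.mem_univ _, ⟨hS, hAU, hA, hAS, hτ⟩, h⟩
  have h1 : (Fintype.card Φ : ℝ) ≤ ∑ P, ((bad P).card : ℝ) := by
    have := (Finset.card_le_card hcover).trans Finset.card_biUnion_le
    rw [Finset.card_univ] at this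
    exact_mod_cast this
  have h2 := h1.trans (Finset.sum_le_sum fun P _ => hbad P)
  rw [Finset.sum_const, Finset.card_univ, nsmul_eq_mul, ← mul_assoc] at h2
  exact absurd h2 (not_le.2 (mul_lt_of_lt_one_left hpos hsmall))

/-- The message law of an encoder `enc` with a uniformly distributed seed. -/
def seedLaw {κ α β : Type*} [Fintype κ] [DecidableEq β] (enc : α → κ → β) (s : α) (v : β) : ℝ :=
  (Fintype.card κ : ℝ)⁻¹ * ∑ c, if enc s c = v then 1 else 0

lemma seedLaw_mem_stdSimplex {κ α β : Type*} [Fintype κ] [Nonempty κ] [Fintype β] [DecidableEq β]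
    (enc : α → κ → β) (s : α) : seedLaw enc s ∈ stdSimplex ℝ β := by
  refine ⟨fun v => mul_nonneg (by positivity) (Finset.sum_nonneg fun c _ => by positivity), ?_⟩
  unfold seedLaw
  rw [← Finset.mul_sum, Finset.sum_comm]
  simp

omit [∀ i, Fintype (𝒳 i)] in
open Classical in
lemma condError_seedLaw {κ : Type*} [Fintype κ] {R : Fin m → ℝ}
    (enc : ∀ i, (Fin n → 𝒳 i) → κ → Fin (numMsg n (R i)))
    (g : Msgs n R → ∀ i, Fin n → 𝒳 i) (H : Finset (Fin m)) (x : Fin n → ∀ i, 𝒳 i)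
    (a : Msgs n R) :
    condError (fun i => seedLaw (enc i)) g H x a = ((Fintype.card κ : ℝ)⁻¹) ^ m *
      (Finset.univ.filter fun c : Fin m → κ => ¬ ∀ i ∈ H,
        g (received H (fun i => enc i (fun k => x k i) (c i)) a) i = fun k => x k i).card := by
  have hprod : ∀ u : Msgs n R, ∏ i, seedLaw (enc i) (fun k => x k i) (u i) =
      ((Fintype.card κ : ℝ)⁻¹) ^ m *
        ∑ c : Fin m → κ, if (fun i => enc i (fun k => x k i) (c i)) = u then 1 else 0 := by
    intro u
    unfold seedLaw
    rw [Finset.prod_mul_distrib, Finset.prod_const, Finset.card_univ, Fintype.card_fin,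
      Fintype.prod_sum]
    congr 1
    refine Finset.sum_congr rfl fun c _ => ?_
    rw [Finset.prod_ite_zero]
    simp [funext_iff]
  unfold condError
  simp only [hprod]
  have : ∀ u : Msgs n R, (if ∀ i ∈ H, g (received H u a) i = fun k => x k i then (0 : ℝ)
      else ((Fintype.card κ : ℝ)⁻¹) ^ m *
        ∑ c : Fin m → κ, if (fun i => enc i (fun k => x k i) (c i)) = u then 1 else 0) =
      ((Fintype.card κ : ℝ)⁻¹) ^ m * ∑ c : Fin m → κ,
        if (fun i => enc i (fun k => x k i) (c i)) = u then
          (if ∀ i ∈ H, g (received H u a) i = fun k => x k i then 0 else 1) else 0 := by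
    intro u
    split_ifs <;> simp
  simp only [this]
  rw [← Finset.mul_sum, Finset.sum_comm, Finset.natCast_card_filter]
  congr 1
  refine Finset.sum_congr rfl fun c _ => ?_
  rw [Finset.sum_ite_eq, if_pos (Finset.mem_univ _), ite_not]

/-- A diagonal with more than `r` bad seed vectors would supply `r` shifts `τ` that contradict
robustness. The seeds on `U` stay at `e` along the diagonal, since the traitors cannot follow the
honest seeds. -/
lemma Robust.card_le {κ : Type*} [Fintype κ] [AddGroup κ] {N : Fin m → ℕ} {δ : ℝ} {k r : ℕ}
    {F : Codebook κ (fun i => Fin n → 𝒳 i) N} (hF : Robust p δ k r F) {S A U : Finset (Fin m)}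
    (hS : S.card = k) (hAU : Disjoint A U) (hA : A.Nonempty) (hAS : A ∪ U ⊆ S)
    (x : ∀ i, Fin n → 𝒳 i) (b : ∀ i, Fin (N i)) (e : Fin m → κ) (B : Finset (Fin m → κ))
    (hB : ∀ c ∈ B, ∃ y, Rival (typSet p δ S n) A U x y ∧
      Collides F A U x b (fun i => if i ∈ U then e i else c i) y) :
    Fintype.card κ * B.card ≤ r * Fintype.card (Fin m → κ) := by
  classical
  refine card_mul_card_le_of_diagonal B r fun o => ?_
  by_contra! hlt
  obtain ⟨J, hJ, hJr⟩ := Finset.exists_subset_card_eq hlt.le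
  let φ := J.equivFinOfCardEq hJr
  obtain ⟨j, hj⟩ := hF S A U hS hAU hA hAS x b (fun i => if i ∈ U then e i else o i)
    (fun j => (φ.symm j : κ)) (Subtype.val_injective.comp φ.symm.injective)
  obtain ⟨y, hy, hc⟩ := hB _ (Finset.mem_filter.1 (hJ (φ.symm j).2)).2
  refine hj y hy ?_
  convert hc using 2 with i
  split_ifs <;> rfl

open Classical in
/-- The probability of an error when a robust codebook is used with random seeds. -/
lemma Robust.condError_le {κ : Type*} [Fintype κ] [Nonempty κ] [AddGroup κ] {N : Fin m → ℕ}
    {δ : ℝ} {r : ℕ} {R : Fin m → ℝ} {F : Codebook κ (fun i => Fin n → 𝒳 i) N}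
    (hF : Robust p δ (m - t) r F) (ht : t < m) {enc : ∀ i, κ × Fin (N i) → Fin (numMsg n (R i))}
    {dec : ∀ i, Fin (numMsg n (R i)) → κ × Fin (N i)} (hdec : ∀ i cb, dec i (enc i cb) = cb)
    (d : ∀ i, Fin n → 𝒳 i) {H : Finset (Fin m)} (hH : Hᶜ.card ≤ t) {x : Fin n → ∀ i, 𝒳 i}
    (hx : Typ p δ Finset.univ x) (a : Msgs n R) :
    condError (fun i => seedLaw fun s c => enc i (c, F ⟨i, c, s⟩))
      (fun I => decode p δ (m - t) d F fun i => dec i (I i)) H x a ≤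
        4 ^ m * r / Fintype.card κ := by
  rw [condError_seedLaw]
  have hκ : (0 : ℝ) < Fintype.card κ := by exact_mod_cast Fintype.card_pos
  let x' : ∀ i, Fin n → 𝒳 i := fun i k => x k i
  -- Bad seeds are sorted by the set `S` of the wrong candidate and the set `A` of its honest
  -- errors, whence the factor `4 ^ m`.
  let B : Finset (Fin m) × Finset (Fin m) → Finset (Fin m → κ) := fun SA =>
    Finset.univ.filter fun c => (SA.1.card = m - t ∧ SA.2 ⊆ SA.1 ∧ SA.2 ⊆ H ∧ SA.2.Nonempty) ∧
      ∃ y, Rival (typSet p δ SA.1 n) SA.2 (SA.1 \ H) x' y ∧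
        Collides F SA.2 (SA.1 \ H) x' (fun i => (dec i (a i)).2)
          (fun i => if i ∈ SA.1 \ H then (dec i (a i)).1 else c i) y
  have hBcard : ∀ SA, ((B SA).card : ℝ) ≤ r * (Fintype.card κ : ℝ) ^ m / Fintype.card κ := by
    intro SA
    rw [le_div_iff₀ hκ, mul_comm]
    have : Fintype.card κ * (B SA).card ≤ r * Fintype.card (Fin m → κ) := by
      by_cases h : SA.1.card = m - t ∧ SA.2 ⊆ SA.1 ∧ SA.2 ⊆ H ∧ SA.2.Nonempty
      · refine hF.card_le h.1 (Finset.disjoint_of_subset_left h.2.2.1 Finset.disjoint_sdiff)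
          h.2.2.2 (Finset.union_subset h.2.1 Finset.sdiff_subset) x' (fun i => (dec i (a i)).2)
          (fun i => (dec i (a i)).1) (B SA) fun c hc => ?_
        have := (Finset.mem_filter.1 hc).2.2
        convert this
      · have : B SA = ∅ := Finset.filter_false_of_mem fun c _ hc => h hc.1
        simp [this]
    rw [Fintype.card_fun, Fintype.card_fin] at this
    exact_mod_cast this
  have hcover : (Finset.univ.filter fun c : Fin m → κ => ¬ ∀ i ∈ H,
      decode p δ (m - t) d F (fun i => dec i (received H
        (fun i => enc i (c i, F ⟨i, c i, fun k => x k i⟩)) a i)) i = fun k => x k i) ⊆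
      Finset.univ.biUnion B := by
    intro c hc
    simp only [Finset.mem_filter, Finset.mem_univ, true_and] at hc
    push Not at hc
    obtain ⟨i, hi, hne⟩ := hc
    set cb : ∀ i, κ × Fin (N i) := fun i => dec i (received H
        (fun i => enc i (c i, F ⟨i, c i, fun k => x k i⟩)) a i) with hcbdef
    have hcb1 : ∀ j ∈ H, cb j = (c j, F ⟨j, c j, x' j⟩) := by
      intro j hj
      simp only [hcbdef, received, hj, if_true, hdec, x']
    have hcb2 : ∀ j ∉ H, cb j = dec j (a j) := by
      intro j hj
      simp only [hcbdef, received, hj, if_false]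
    have hcb : ∀ j ∈ H, F ⟨j, (cb j).1, x' j⟩ = (cb j).2 := fun j hj => by rw [hcb1 j hj]
    obtain ⟨S, y, hy, hyx⟩ := exists_candidate_of_decode_ne (x := x') ht hH
      (mem_typSet.2 hx) hcb hi hne
    obtain ⟨A, hA, hAS, hAH, y', hy', hc'⟩ := hy.exists_rival hcb le_rfl hy.1 hi hyx
    refine Finset.mem_biUnion.2 ⟨(S, A), Finset.mem_univ _, Finset.mem_filter.2
      ⟨Finset.mem_univ _, ⟨hy.2.1, hAS, hAH, hA⟩, y', hy', fun j hj => ?_, fun j hj => ?_⟩⟩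
    · have hjH := hAH hj
      have e : (if j ∈ S \ H then (dec j (a j)).1 else c j) = (cb j).1 := by
        simp [hjH, hcb1 j hjH]
      dsimp only at hj ⊢
      rw [e]
      exact hc'.1 j hj
    · have hjH := (Finset.mem_sdiff.1 hj).2
      dsimp only at hj ⊢
      rw [if_pos hj, ← hcb2 j hjH]
      exact hc'.2 j hj
  have hle : ((Finset.univ.filter fun c : Fin m → κ => ¬ ∀ i ∈ H,
      decode p δ (m - t) d F (fun i => dec i (received H
        (fun i => enc i (c i, F ⟨i, c i, fun k => x k i⟩)) a i)) i = fun k => x k i).card : ℝ) ≤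
      4 ^ m * (r * (Fintype.card κ : ℝ) ^ m / Fintype.card κ) := by
    refine (Nat.cast_le.2 ((Finset.card_le_card hcover).trans Finset.card_biUnion_le)).trans ?_
    rw [Nat.cast_sum]
    refine (Finset.sum_le_sum fun SA _ => hBcard SA).trans (le_of_eq ?_)
    rw [Finset.sum_const, Finset.card_univ, Fintype.card_prod, Fintype.card_finset,
      Fintype.card_fin, nsmul_eq_mul]
    push_cast
    rw [← mul_pow]
    norm_num
  refine (mul_le_mul_of_nonneg_left hle (by positivity)).trans (le_of_eq ?_)
  rw [inv_pow]
  field_simp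

end ByzantineSource

/-! ### Choice of the parameters for randomized coding. -/

namespace ByzantineSource

variable {m : ℕ} {𝒳 : Fin m → Type*} [∀ i, Fintype (𝒳 i)] [∀ i, DecidableEq (𝒳 i)]
  {p : (∀ i, 𝒳 i) → ℝ} {t n : ℕ}

omit [∀ i, DecidableEq (𝒳 i)] in
lemma card_choices_mul_le {κ : Type*} [Fintype κ] [DecidableEq κ] {R : Fin m → ℝ} {N : Fin m → ℕ}
    (hN : ∀ i, N i ≤ numMsg n (R i)) (r : ℕ) {c δ : ℝ} (hc : 0 ≤ c) :
    (Fintype.card ((Finset (Fin m) × Finset (Fin m) × Finset (Fin m)) ×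
      (∀ i, Fin n → 𝒳 i) × (∀ i, Fin (N i)) × (Fin m → κ) × (Fin r → κ)) : ℝ) *
        ((r : ℝ) ^ m * (c ^ m * (2 : ℝ) ^ (-(n * (δ / 2))))) ^ r ≤
      (8 ^ m * (Fintype.card κ : ℝ) ^ m * (Fintype.card κ : ℝ) ^ r * ((r : ℝ) ^ m * c ^ m) ^ r) *
        ((∏ i, (Fintype.card (𝒳 i) : ℝ)) * (2 : ℝ) ^ (∑ i, R i) *
          ((2 : ℝ) ^ (-(δ / 2))) ^ r) ^ n := by
  have h1 : ∏ i, (N i : ℝ) ≤ ((2 : ℝ) ^ (∑ i, R i)) ^ n := by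
    rw [← Real.rpow_natCast, ← Real.rpow_mul zero_le_two, mul_comm]
    exact (Finset.prod_le_prod (fun i _ => Nat.cast_nonneg _) fun i _ =>
      Nat.cast_le.2 (hN i)).trans (prod_numMsg_le n R Finset.univ)
  have h2 : (2 : ℝ) ^ (-(n * (δ / 2))) = ((2 : ℝ) ^ (-(δ / 2))) ^ n := by
    rw [← Real.rpow_natCast, ← Real.rpow_mul zero_le_two]
    congr 1
    ring
  have h3 : (Fintype.card ((Finset (Fin m) × Finset (Fin m) × Finset (Fin m)) ×
      (∀ i, Fin n → 𝒳 i) × (∀ i, Fin (N i)) × (Fin m → κ) × (Fin r → κ)) : ℝ) =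
      8 ^ m * (∏ i, (Fintype.card (𝒳 i) : ℝ)) ^ n * (∏ i, (N i : ℝ)) *
        (Fintype.card κ : ℝ) ^ m * (Fintype.card κ : ℝ) ^ r := by
    simp only [Fintype.card_prod, Fintype.card_finset, Fintype.card_fin, Fintype.card_pi,
      Finset.prod_const, Finset.card_univ]
    push_cast
    rw [Finset.prod_pow, show (8 : ℝ) = 2 * (2 * 2) by norm_num, mul_pow, mul_pow]
    ring
  rw [h3, h2]
  calc _ ≤ 8 ^ m * (∏ i, (Fintype.card (𝒳 i) : ℝ)) ^ n * ((2 : ℝ) ^ (∑ i, R i)) ^ n *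
        (Fintype.card κ : ℝ) ^ m * (Fintype.card κ : ℝ) ^ r *
        ((r : ℝ) ^ m * (c ^ m * ((2 : ℝ) ^ (-(δ / 2))) ^ n)) ^ r := by gcongr
    _ = _ := by ring

/-- With `M` messages and `Q = ⌊M / C⌋ ≥ 1`, one has `M + 1 ≤ C * Q + C ≤ 2 * C * Q`: reserving room
for `C` seeds costs only a constant factor. -/
lemma rpow_le_mul_numMsg_div {C : ℕ} (hC : 0 < C) {r : ℝ} (h : C ≤ numMsg n r) :
    (2 : ℝ) ^ (n * r) ≤ 2 * C * ((numMsg n r / C : ℕ) : ℝ) := by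
  have h1 : (2 : ℝ) ^ (n * r) < numMsg n r + 1 := Nat.lt_floor_add_one _
  have h2 : numMsg n r < numMsg n r / C * C + C := Nat.lt_div_mul_add hC
  have h3 : 1 ≤ numMsg n r / C := (Nat.one_le_div_iff hC).2 h
  have h4 : numMsg n r + 1 ≤ 2 * C * (numMsg n r / C) := by nlinarith
  have h5 : ((numMsg n r : ℝ) + 1) ≤ 2 * C * ((numMsg n r / C : ℕ) : ℝ) := by exact_mod_cast h4
  linarith

lemma eventually_le_numMsg (C : ℕ) {r : ℝ} (hr : 0 < r) : ∀ᶠ n in atTop, C ≤ numMsg n r := by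
  have := (tendsto_two_rpow_neg hr).eventually
    (gt_mem_nhds (show (0 : ℝ) < ((C : ℝ) + 1)⁻¹ by positivity))
  filter_upwards [this] with n hn
  rw [Real.rpow_neg zero_le_two, inv_lt_inv₀ (by positivity) (by positivity)] at hn
  exact Nat.le_floor (by linarith)

lemma mem_randAchievable_of_slack (hp : ∀ x, 0 ≤ p x) (h1 : ∑ x, p x = 1) (ht : t < m) {δ : ℝ}
    (hδ : 0 < δ) {R : Fin m → ℝ} (hR : Slack p (m - t) δ R) : R ∈ randAchievable p t := by
  classical
  intro ε hε
  obtain ⟨x₀⟩ := nonempty_of_sum_eq_one h1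
  -- `K ^ n` bounds the number of choices of sources and bins. First `r` is taken with `K * 2 ^ (-r
  -- δ / 2) < 1`, then `C` with `4 ^ m * r / C ≤ ε / 2`; neither depends on `n`.
  set K : ℝ := (∏ i, (Fintype.card (𝒳 i) : ℝ)) * (2 : ℝ) ^ (∑ i, R i) with hK
  have hK0 : 0 ≤ K := by positivity
  obtain ⟨r, hr⟩ := exists_pow_lt_of_lt_one (show (0 : ℝ) < (K + 1)⁻¹ by positivity)
    (Real.rpow_lt_one_of_one_lt_of_neg one_lt_two (show -(δ / 2) < 0 by linarith))
  have hρ : K * ((2 : ℝ) ^ (-(δ / 2))) ^ r < 1 := by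
    have := (mul_lt_mul_of_pos_left hr (show (0 : ℝ) < K + 1 by positivity))
    rw [mul_inv_cancel₀ (by positivity)] at this
    exact (mul_le_mul_of_nonneg_right (by linarith) (by positivity)).trans_lt this
  obtain ⟨C, hC⟩ := exists_nat_gt (4 ^ m * r / (ε / 2))
  have hC0 : 0 < C := by
    have : (0 : ℝ) < C := lt_of_le_of_lt (by positivity) hC
    exact_mod_cast this
  have hCε : 4 ^ m * r / (C : ℝ) ≤ ε / 2 := by
    have : (0 : ℝ) < C := by exact_mod_cast hC0
    rw [div_lt_iff₀ (by positivity)] at hC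
    rw [div_le_iff₀ this]
    linarith
  have : NeZero C := ⟨hC0.ne'⟩
  have hcard : Fintype.card (ZMod C) = C := ZMod.card C
  have hlim := (tendsto_pow_atTop_nhds_zero_of_lt_one (by positivity) hρ).const_mul
    (8 ^ m * (Fintype.card (ZMod C) : ℝ) ^ m * (Fintype.card (ZMod C) : ℝ) ^ r *
      ((r : ℝ) ^ m * (2 * C : ℝ) ^ m) ^ r)
  rw [mul_zero] at hlim
  filter_upwards [hlim.eventually (gt_mem_nhds one_pos),
    (tendsto_blockProb_not_typ hp h1 (half_pos hδ)).eventually (gt_mem_nhds (half_pos hε)),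
    eventually_all.2 fun i => eventually_le_numMsg C (hR.1 i)] with n hn1 hn2 hn3
  let N : Fin m → ℕ := fun i => numMsg n (R i) / C
  have hN0 : ∀ i, 0 < N i := fun i => Nat.div_pos (hn3 i) hC0
  have hC1 : (1 : ℝ) ≤ C := by exact_mod_cast hC0
  obtain ⟨F, hF⟩ := exists_robust (κ := ZMod C) (N := N) hp hR (c := 2 * C) (by linarith) hN0
    (fun i => rpow_le_mul_numMsg_div hC0 (hn3 i)) r
    ((card_choices_mul_le (fun i => Nat.div_le_self _ _) r (by positivity)).trans_lt hn1)
  -- Seed and bin together fit into one message.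
  have hemb : ∀ i, Nonempty (ZMod C × Fin (N i) ↪ Fin (numMsg n (R i))) := by
    intro i
    refine Function.Embedding.nonempty_of_card_le ?_
    rw [Fintype.card_prod, hcard, Fintype.card_fin, Fintype.card_fin]
    exact Nat.mul_div_le _ _
  let enc := fun i => (hemb i).some
  have hne : ∀ i, Nonempty (ZMod C × Fin (N i)) := fun i => ⟨(0, ⟨0, hN0 i⟩)⟩
  let dec := fun i => Function.invFun (enc i)
  have hdec : ∀ i cb, dec i (enc i cb) = cb := fun i =>
    Function.leftInverse_invFun (enc i).injective
  refine ⟨fun i => seedLaw fun s c => enc i (c, F ⟨i, c, s⟩),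
    fun I => decode p (δ / 2) (m - t) (fun i _ => x₀ i) F fun i => dec i (I i),
    fun i s => seedLaw_mem_stdSimplex _ s, ?_⟩
  intro H hH T hT
  refine (errorProb_le hp hT (E := fun x => (if ¬ Typ p (δ / 2) Finset.univ x then 1 else 0) + ε / 2)
    ?_).trans ?_
  · intro x a
    by_cases hx : Typ p (δ / 2) Finset.univ x
    · rw [if_neg (not_not.2 hx), zero_add]
      have := hF.condError_le ht (enc := fun i => enc i) hdec (fun i _ => x₀ i) hH hx a
      rw [hcard] at this
      exact this.trans hCε
    · rw [if_pos hx]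
      refine le_trans ?_ (show (1 : ℝ) ≤ 1 + ε / 2 by linarith)
      rw [condError_seedLaw, hcard]
      have : ((Finset.univ.filter fun c : Fin m → ZMod C => ¬ ∀ i ∈ H,
          decode p (δ / 2) (m - t) (fun i _ => x₀ i) F (fun i => dec i (received H
            (fun i => enc i (c i, F ⟨i, c i, fun k => x k i⟩)) a i)) i =
              fun k => x k i).card : ℝ) ≤ (C : ℝ) ^ m := by
        have := Finset.card_le_univ (Finset.univ.filter fun c : Fin m → ZMod C => ¬ ∀ i ∈ H,
          decode p (δ / 2) (m - t) (fun i _ => x₀ i) F (fun i => dec i (received H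
            (fun i => enc i (c i, F ⟨i, c i, fun k => x k i⟩)) a i)) i = fun k => x k i)
        rw [Fintype.card_fun, hcard, Fintype.card_fin] at this
        exact_mod_cast this
      rw [inv_pow, inv_mul_le_iff₀ (by positivity), mul_one]
      convert this
  · simp only [mul_add, Finset.sum_add_distrib, mul_ite, mul_one, mul_zero]
    rw [← blockProb_eq_sum_ite, ← Finset.sum_mul, sum_prod_block h1, one_mul]
    linarith

end ByzantineSource

end

theorem theorem2 {m : ℕ} {𝒳 : Fin m → Type*} [∀ i, Fintype (𝒳 i)] [∀ i, DecidableEq (𝒳 i)]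
    (p : (∀ i, 𝒳 i) → ℝ) (hp : p ∈ stdSimplex ℝ (∀ i, 𝒳 i)) (t : ℕ) (ht : t < m) :
    closure (ByzantineSource.detAchievable p t) =
        ByzantineSource.rateRegion p (max 1 (m - 2 * t)) ∧
      closure (ByzantineSource.randAchievable p t) =
        ByzantineSource.rateRegion p (m - t) :=
  ⟨ByzantineSource.closure_eq_rateRegion hp.1 (le_max_left _ _) (by omega)
      (ByzantineSource.detAchievable_subset hp.1 hp.2)
      fun _ hδ _ => ByzantineSource.mem_detAchievable_of_slack hp.1 hp.2 ht hδ,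
    ByzantineSource.closure_eq_rateRegion hp.1 (by omega) (Nat.sub_le m t)
      (ByzantineSource.randAchievable_subset hp.1 hp.2 ht)
      fun _ hδ _ => ByzantineSource.mem_randAchievable_of_slack hp.1 hp.2 ht hδ⟩
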